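/- Let $k\ge 2$ and $\alpha,\beta,\gamma,\delta\in\mathbb{C}$, put $q:=1+\beta\gamma-\alpha\delta$ and $[n]:=1+q+\cdots+q^{n-1}$ (that is, $\frac{1-q^n}{1-q}$ for $q\ne 1$), $[n]!:=[1][2]\cdots[n]$, $[0]!:=1$. Assume $q\neq 0$ and $1+\beta\gamma[n]\neq 0$ for all integers $n\ge 1$. Let $L=\bigoplus_{i=1}^k\mathbb{Z}v_i$ with coordinate functions $\epsilon_1,\dots,\epsilon_k$, let $W=\mathfrak{S}_k$ act on $L$ by permuting the $v_i$, let $L_+=\{x\in L:\epsilon_1(x)\ge\cdots\ge\epsilon_k(x)\}$, let $F(L)$ be the space of functions $L\to\mathbb{C}$, and let $F(L)^W$ be the subspace of $W$-invariant functions. Put $(\widehat X_if)(x):=f(x-v_i)$, $d_i^+(x):=\#\{p>i:\epsilon_p(x)=\epsilon_i(x)\}$, $d_i^-(x):=\#\{p<i:\epsilon_p(x)=\epsilon_i(x)\}$, and let $\delta_{j_1,\dots,j_r}(x)$ be $1$ if $\epsilon_{j_1}(x)=\cdots=\epsilon_{j_r}(x)$ and $0$ otherwise. The discrete Hamiltonian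 is the linear operator on $F(L)$ $$H=-\alpha\gamma\sum_{j=1}^k\frac{[d_j^+]}{1+\beta\gamma[d_j^+]}+\sum_{r=1}^k(-\beta\delta)^{r-1}[r-1]!\,q^{-r(r-1)/2}\sum_{1\le j_1<\cdots<j_r\le k}\frac{q^{\sum_{p=1}^r d_{j_p}^-}\,\delta_{j_1,\dots,j_r}}{\prod_{p=0}^{r-1}\left(1+\beta\gamma[d_{j_1}^++d_{j_1}^--p]\right)}\prod_{p=1}^r\widehat X_{j_p},$$ where the summand is $0$ at points where $\delta_{j_1,\dots,j_r}$ vanishes. Let $p_1,\dots,p_k$ be distinct nonzero complex numbers, put $$A_\sigma:=\prod_{1\le i<j\le k}\left(1+\frac{(\alpha+\beta p_{\sigma(j)})(\gamma+\delta p_{\sigma(i)})}{p_{\sigma(j)}-p_{\sigma(i)}}\right)\qquad(\sigma\in\mathfrak{S}_k),$$ and let $\Phi_p\in F(L)^W$ be the $W$-invariant function with $$\Phi_p(x)=\sum_{\sigma\in\mathfrak{S}_k}A_\sigma\prod_{i=1}^kp_{\sigma(i)}^{-\epsilon_i(x)}\qquad(x\in L_+).$$ Then $H\Phi_p=\left(\sum_{i=1}^kp_i\right)\Phi_p$.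 Moreover $\Phi_p$ is not identically zero if and only if $A_\sigma\ne 0$ for some $\sigma\in\mathfrak{S}_k$, and this is automatic when $[n]\neq 0$ for all $2\le n\le k$; in that case $\Phi_p$ is an eigenfunction (a nonzero eigenvector) of $H$ with eigenvalue $\sum_{i=1}^kp_i$. -/

import Mathlib

noncomputable section

namespace BetheWave

/-- The deformation parameter `q = 1 + βγ - αδ`. -/
def qParam (α β γ δ : ℂ) : ℂ := 1 + β * γ - α * δ

/-- The `q`-integer `[n] = 1 + q + ⋯ + q ^ (n - 1)`, which is `(1 - q ^ n) / (1 - q)` for `q ≠ 1`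
and `n` for `q = 1`. -/
def qInt (q : ℂ) (n : ℕ) : ℂ := ∑ i ∈ Finset.range n, q ^ i

theorem qInt_eq_div (q : ℂ) (hq : q ≠ 1) (n : ℕ) : qInt q n = (1 - q ^ n) / (1 - q) := by
  rw [qInt, geom_sum_eq hq, ← neg_div_neg_eq, neg_sub, neg_sub]

/-- The `q`-factorial `[n]! = [1] [2] ⋯ [n]`, with `[0]! = 1`. -/
def qFactorial (q : ℂ) (n : ℕ) : ℂ := ∏ a ∈ Finset.Icc 1 n, qInt q a

/-- The lattice `L = ⊕ ℤ v_i`, written in the coordinates `x i = ε_i(x)`. -/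
abbrev Lattice (k : ℕ) : Type := Fin k → ℤ

/-- The basis vector `v_i` of `L`. -/
def basisVec {k : ℕ} (i : Fin k) : Lattice k := Pi.single i 1

/-- `F(L)^W`: the functions on `L` that are invariant under the Weyl group of type `A_{k-1}`, that
is, under the symmetric group acting by permutations of the coordinates.  Here `(w f)(x)` is
`f (w⁻¹ x)`, and `w v_i = v_{w(i)}` gives `(w⁻¹ x) i = x (w i)`. -/
def weylInvariants (k : ℕ) : Submodule ℂ (Lattice k → ℂ) where
  carrier := {f | ∀ (w : Equiv.Perm (Fin k)) (x : Lattice k), f (fun i => x (w i)) = f x}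
  add_mem' := by
    intro f g hf hg w x
    simp only [Pi.add_apply, hf w x, hg w x]
  zero_mem' := by
    intro w x
    rfl
  smul_mem' := by
    intro c f hf w x
    simp only [Pi.smul_apply, hf w x]

/-- `L_+`: the lattice points `x` with `x_1 ≥ x_2 ≥ ⋯ ≥ x_k`. -/
def dominantChamber (k : ℕ) : Set (Lattice k) := {x | Antitone x}

/-- The operator `X̂_i` on functions on `L`: `(X̂_i f)(x) = f (x - v_i)`. -/
def shiftOp {k : ℕ} (i : Fin k) : Module.End ℂ (Lattice k → ℂ) :=
  LinearMap.funLeft ℂ ℂ (fun x : Lattice k => x - basisVec i)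

/-- The operator of multiplication by the function `g`. -/
def mulOp {k : ℕ} (g : Lattice k → ℂ) : Module.End ℂ (Lattice k → ℂ) :=
  LinearMap.mulLeft ℂ g

/-- `d_i^+(x)`: the number of `p` with `i < p` and `x_i = x_p`. -/
def dPlus {k : ℕ} (i : Fin k) (x : Lattice k) : ℕ :=
  (Finset.univ.filter fun p : Fin k => i < p ∧ x i = x p).card

/-- `d_i^-(x)`: the number of `p` with `p < i` and `x_p = x_i`. -/
def dMinus {k : ℕ} (i : Fin k) (x : Lattice k) : ℕ :=
  (Finset.univ.filter fun p : Fin k => p < i ∧ x p = x i).card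

open Classical in
/-- `δ_{j_1, …, j_r}(x)`: it is `1` if the coordinates of `x` at `j_1, …, j_r` are all equal, and
`0` otherwise. -/
def deltaFun {k r : ℕ} (j : Fin r → Fin k) (x : Lattice k) : ℂ :=
  if ∀ a b : Fin r, x (j a) = x (j b) then 1 else 0

/-- The coefficient function of `X̂_{j_1} ⋯ X̂_{j_r}` in the discrete Hamiltonian (`r ≥ 1`; the index
`j_1` is `j 0`).  Where `deltaFun j x` is not `0` and the `j_i` are distinct, one has
`d⁺ + d⁻ ≥ r - 1`, so the subtraction of natural numbers is the true one. -/
def hamiltonianCoeff (α β γ δ : ℂ) {k : ℕ} (r : ℕ) [NeZero r] (j : Fin r → Fin k) (x : Lattice k) :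
    ℂ :=
  let q := qParam α β γ δ
  (-(β * δ)) ^ (r - 1) * qFactorial q (r - 1) * (q ^ (r * (r - 1) / 2))⁻¹ *
    (q ^ (∑ a : Fin r, dMinus (j a) x) * deltaFun j x /
      ∏ a ∈ Finset.range r, (1 + β * γ * qInt q (dPlus (j 0) x + dMinus (j 0) x - a)))

open Classical in
/-- The discrete Hamiltonian `H`.  The sum over `1 ≤ r ≤ k` is written with `r = s + 1`, `s < k`, and
the sum over `j_1 < ⋯ < j_r` is the sum over the strictly increasing maps
`Fin r → Fin k`. -/
def hamiltonian (k : ℕ) (α β γ δ : ℂ) : Module.End ℂ (Lattice k → ℂ) :=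
  -(α * γ) • ∑ j : Fin k, mulOp (fun x : Lattice k =>
      qInt (qParam α β γ δ) (dPlus j x) / (1 + β * γ * qInt (qParam α β γ δ) (dPlus j x)))
    + ∑ s ∈ Finset.range k,
        ∑ j ∈ Finset.univ.filter (fun j : Fin (s + 1) → Fin k => StrictMono j),
          mulOp (hamiltonianCoeff α β γ δ (s + 1) j) *
            (List.ofFn fun a : Fin (s + 1) => shiftOp (j a)).prod

/-- The coefficient
`∏_{i < j} (1 + (α + β p_{σ(j)}) (γ + δ p_{σ(i)}) / (p_{σ(j)} - p_{σ(i)}))`. -/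
def betheCoeff {k : ℕ} (α β γ δ : ℂ) (p : Fin k → ℂ) (σ : Equiv.Perm (Fin k)) : ℂ :=
  ∏ i : Fin k, ∏ j ∈ Finset.Ioi i,
    (1 + (α + β * p (σ j)) * (γ + δ * p (σ i)) / (p (σ j) - p (σ i)))

/-- The Bethe sum
`∑_σ betheCoeff σ * ∏_i p_{σ(i)} ^ (-ε_i(x))`, as a function on the whole lattice. -/
def betheSum {k : ℕ} (α β γ δ : ℂ) (p : Fin k → ℂ) (x : Lattice k) : ℂ :=
  ∑ σ : Equiv.Perm (Fin k), betheCoeff α β γ δ p σ * ∏ i : Fin k, p (σ i) ^ (-x i)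

/-- The point of the Weyl orbit of `x` in `L_+`: the decreasing rearrangement of `x`. -/
def dominantRep {k : ℕ} (x : Lattice k) : Lattice k :=
  fun i => x (Tuple.sort (fun j => -x j) i)

theorem dominantRep_mem {k : ℕ} (x : Lattice k) : dominantRep x ∈ dominantChamber k := by
  intro i j hij
  have h := Tuple.monotone_sort (fun j => -x j) hij
  simpa [dominantRep] using h

/-- The Bethe wave function `Φ_p`: the `W`-invariant function on `L` whose restriction to `L_+` is the
Bethe sum. -/
def betheFunction {k : ℕ} (α β γ δ : ℂ) (p : Fin k → ℂ) : Lattice k → ℂ :=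
  fun x => betheSum α β γ δ p (dominantRep x)

end BetheWave

end

open BetheWave

noncomputable section

namespace BetheWave

open Finset

/-! `H` lowers sets of equal coordinates, so it acts on each level (the coordinates of `x` equal to
a given `c`) separately. By invariance `Φ_p (x - ∑_{i ∈ J} v_i)`, for `J` inside a level, depends
only on `r = |J|`: the decreasing rearrangement replaces the last `r` entries `c` by `c - 1`.
Summing `q ^ (∑ d⁻)` over these `J` gives `q ^ (r(r-1)/2)` times a `q`-binomial coefficient.

The Bethe sum at a decreasing point splits over the ways to distribute the `p_i` among the levels
(`orderedSum_append`). The cross factors depend only on the distribution, so it suffices to treat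
one level, to which a set `s` of `m` parameters is allotted. There the orderings sum to
`q`-factorials, and what remains is the identity `sum_subsetCoeff_mul_subsetWeight`: a combination
of the sums over `r`-subsets `I` of `∏_{j ∈ I} j * ∏_{i ∉ I, j ∈ I} pairFactor i j` equals `∑_{z ∈
s} z` plus a constant, which the diagonal term of `H` removes. Adding up the levels gives the
eigenvalue `∑ p_i` (`sum_levelTerm`).

That identity, and the evaluation of the sums over orderings, follow by induction on `s` from
`sum_subsetWeight_insert_eq`, which tells how subset sums change when a point `t` is adjoined. Its
two sides, multiplied by `∏_{j ∈ s} (t - j)`, are polynomials in `t` of degree at most `|s| + 1`;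
they agree on `s` and at the two values of `t` where every pair factor involving `t` is `1` or `q`.

Nonvanishing is linear independence of distinct characters on `L_+`, together with `Φ_p(0) = [k]!`.
-/

/-- The two-body factor of the Bethe coefficients. -/
def pairFactor (α β γ δ u v : ℂ) : ℂ := 1 + (α + β * v) * (γ + δ * u) / (v - u)

/-- The product of the weights `w j` for `j ∈ I` and of the two-body factors between the complement
of `I` in `s` and `I`. -/
def subsetWeight (α β γ δ : ℂ) (w : ℂ → ℂ) (s I : Finset ℂ) : ℂ :=
  ∏ j ∈ I, (w j * ∏ i ∈ s \ I, pairFactor α β γ δ i j)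

theorem qInt_zero (q : ℂ) : qInt q 0 = 0 := by simp [qInt]

theorem qInt_one (q : ℂ) : qInt q 1 = 1 := by simp [qInt]

theorem qInt_succ (q : ℂ) (n : ℕ) : qInt q (n + 1) = 1 + q * qInt q n := by
  simp only [qInt, Finset.sum_range_succ', Finset.mul_sum, pow_succ']
  simp [add_comm]

theorem qInt_mul_sub (q : ℂ) (n : ℕ) : (q - 1) * qInt q n = q ^ n - 1 := by
  rw [qInt, mul_geom_sum]

theorem qInt_add (q : ℂ) (r n : ℕ) :
    qInt q (r + n) = qInt q r + qInt q n + (q - 1) * qInt q r * qInt q n := by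
  have h : qInt q (r + n) = qInt q r + q ^ r * qInt q n := by
    simp [qInt, Finset.sum_range_add, Finset.mul_sum, pow_add]
  rw [h, qInt_mul_sub]; ring

theorem qFactorial_zero (q : ℂ) : qFactorial q 0 = 1 := by simp [qFactorial]

theorem qFactorial_succ (q : ℂ) (n : ℕ) :
    qFactorial q (n + 1) = qFactorial q n * qInt q (n + 1) := by
  simp [qFactorial, Finset.prod_Icc_succ_top]

/-! ### Sums over subsets: the recursion in the ground set and its consequences. -/

section subsets

variable (α β γ δ : ℂ)

theorem subsetWeight_empty (w : ℂ → ℂ) (s : Finset ℂ) : subsetWeight α β γ δ w s ∅ = 1 := by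
  simp [subsetWeight]

theorem subsetWeight_insert (w : ℂ → ℂ) {s I : Finset ℂ} {t : ℂ} (ht : t ∉ s) (hI : I ⊆ s) :
    subsetWeight α β γ δ w (insert t s) I =
      subsetWeight α β γ δ w s I * ∏ j ∈ I, pairFactor α β γ δ t j := by
  have h : insert t s \ I = insert t (s \ I) := insert_sdiff_of_notMem _ fun h => ht (hI h)
  rw [subsetWeight, h, subsetWeight, ← prod_mul_distrib]
  refine prod_congr rfl fun j _ => ?_
  rw [prod_insert (by simp [ht])]; ring

theorem subsetWeight_insert_insert (w : ℂ → ℂ) {s I : Finset ℂ} {t : ℂ} (ht : t ∉ s) (hI : I ⊆ s) :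
    subsetWeight α β γ δ w (insert t s) (insert t I) =
      subsetWeight α β γ δ w s I * (w t * ∏ i ∈ s \ I, pairFactor α β γ δ i t) := by
  have h : insert t s \ insert t I = s \ I := by
    rw [insert_sdiff_insert, sdiff_insert_of_notMem ht]
  rw [subsetWeight, h, prod_insert fun h => ht (hI h), subsetWeight, mul_comm]

theorem sum_subsetWeight_insert (u : ℕ → ℂ) (w : ℂ → ℂ) {s : Finset ℂ} {t : ℂ} (ht : t ∉ s) :
    ∑ I ∈ (insert t s).powerset, u I.card * subsetWeight α β γ δ w (insert t s) I =
      ∑ I ∈ s.powerset, subsetWeight α β γ δ w s I *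
        (u I.card * ∏ j ∈ I, pairFactor α β γ δ t j +
          u (I.card + 1) * (w t * ∏ i ∈ s \ I, pairFactor α β γ δ i t)) := by
  rw [sum_powerset_insert ht, ← sum_add_distrib]
  refine sum_congr rfl fun I hI => ?_
  have hI := mem_powerset.1 hI
  rw [subsetWeight_insert _ _ _ _ _ ht hI, subsetWeight_insert_insert _ _ _ _ _ ht hI,
    card_insert_of_notMem fun h => ht (hI h)]
  ring

/-- The polynomial obtained from `(v - u) * pairFactor α β γ δ u v`. -/
def pairNumerator (u v : ℂ) : ℂ := v - u + (α + β * v) * (γ + δ * u)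

variable {α β γ δ}

theorem sub_mul_pairFactor {u v : ℂ} (h : u ≠ v) :
    (v - u) * pairFactor α β γ δ u v = pairNumerator α β γ δ u v := by
  have : v - u ≠ 0 := sub_ne_zero.2 h.symm
  rw [pairFactor, pairNumerator]; field_simp

theorem pairFactor_of_left_root {u v : ℂ} (h : γ + δ * u = 0) : pairFactor α β γ δ u v = 1 := by
  simp [pairFactor, h]

theorem pairFactor_of_right_root {u v : ℂ} (h : α + β * v = 0) : pairFactor α β γ δ u v = 1 := by
  simp [pairFactor, h]

theorem pairFactor_left_of_root {u v : ℂ} (huv : u ≠ v) (h : α + β * u = 0) :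
    pairFactor α β γ δ u v = qParam α β γ δ := by
  have : v - u ≠ 0 := sub_ne_zero.2 huv.symm
  have hα : α = -(β * u) := by linear_combination h
  rw [pairFactor, qParam, hα]; field_simp; ring

theorem pairFactor_right_of_root {u v : ℂ} (huv : u ≠ v) (h : γ + δ * v = 0) :
    pairFactor α β γ δ u v = qParam α β γ δ := by
  have : v - u ≠ 0 := sub_ne_zero.2 huv.symm
  have hα : γ = -(δ * v) := by linear_combination h
  rw [pairFactor, qParam, hα]; field_simp; ring

variable (α β γ δ)

/-- `sum_subsetWeight_insert` with denominators cleared, summand for `I`. -/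
def clearedSummand (u : ℕ → ℂ) (w : ℂ → ℂ) (s I : Finset ℂ) (t : ℂ) : ℂ :=
  subsetWeight α β γ δ w s I *
    (u I.card * ((∏ j ∈ I, -pairNumerator α β γ δ t j) * ∏ i ∈ s \ I, (t - i)) +
      u (I.card + 1) * (w t * ((∏ j ∈ I, (t - j)) * ∏ i ∈ s \ I, pairNumerator α β γ δ i t)))

theorem prod_mul_sum_subsetWeight_insert (u : ℕ → ℂ) (w : ℂ → ℂ) {s : Finset ℂ} {t : ℂ}
    (ht : t ∉ s) :
    (∏ j ∈ s, (t - j)) *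
      ∑ I ∈ (insert t s).powerset, u I.card * subsetWeight α β γ δ w (insert t s) I =
      ∑ I ∈ s.powerset, clearedSummand α β γ δ u w s I t := by
  rw [sum_subsetWeight_insert _ _ _ _ _ _ ht, mul_sum]
  refine sum_congr rfl fun I hI => ?_
  have hI := mem_powerset.1 hI
  have h1 : ∏ j ∈ I, -pairNumerator α β γ δ t j =
      (∏ j ∈ I, (t - j)) * ∏ j ∈ I, pairFactor α β γ δ t j := by
    rw [← prod_mul_distrib]
    refine prod_congr rfl fun j hj => ?_
    rw [← sub_mul_pairFactor (ne_of_mem_of_not_mem (hI hj) ht).symm]; ring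
  have h2 : ∏ i ∈ s \ I, pairNumerator α β γ δ i t =
      (∏ j ∈ s \ I, (t - j)) * ∏ i ∈ s \ I, pairFactor α β γ δ i t := by
    rw [← prod_mul_distrib]
    refine prod_congr rfl fun j hj => ?_
    rw [← sub_mul_pairFactor (ne_of_mem_of_not_mem (mem_sdiff.1 hj).1 ht)]
  rw [clearedSummand, h1, h2, ← prod_sdiff hI]
  ring

/-- The apparent poles at `t ∈ s` cancel in pairs: for `t ∉ I`, one product in each of the summands
for `I` and `insert t I` contains `t - t`, and the surviving ones are opposite. -/
theorem sum_clearedSummand_eq_zero (u : ℕ → ℂ) (w : ℂ → ℂ) {s : Finset ℂ} {t : ℂ}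
    (ht : t ∈ s) : ∑ I ∈ s.powerset, clearedSummand α β γ δ u w s I t = 0 := by
  obtain ⟨s', hts, rfl⟩ : ∃ s', t ∉ s' ∧ insert t s' = s :=
    ⟨s.erase t, notMem_erase _ _, insert_erase ht⟩
  rw [sum_powerset_insert hts, ← sum_add_distrib]
  refine sum_eq_zero fun I hI => ?_
  have hI := mem_powerset.1 hI
  have htI : t ∉ I := fun h => hts (hI h)
  have e1 : insert t s' \ I = insert t (s' \ I) := insert_sdiff_of_notMem _ htI
  have e2 : insert t s' \ insert t I = s' \ I := by
    rw [insert_sdiff_insert, sdiff_insert_of_notMem hts]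
  have h3 : t ∉ s' \ I := by simp [hts]
  have h1 : ∏ j ∈ I, -pairNumerator α β γ δ t j =
      (∏ j ∈ I, (t - j)) * ∏ j ∈ I, pairFactor α β γ δ t j := by
    rw [← prod_mul_distrib]
    refine prod_congr rfl fun j hj => ?_
    rw [← sub_mul_pairFactor (ne_of_mem_of_not_mem hj htI).symm]; ring
  have h2 : ∏ i ∈ s' \ I, pairNumerator α β γ δ i t =
      (∏ j ∈ s' \ I, (t - j)) * ∏ i ∈ s' \ I, pairFactor α β γ δ i t := by
    rw [← prod_mul_distrib]
    refine prod_congr rfl fun j hj => ?_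
    rw [← sub_mul_pairFactor (ne_of_mem_of_not_mem hj h3)]
  rw [clearedSummand, clearedSummand, subsetWeight_insert _ _ _ _ _ hts hI,
    subsetWeight_insert_insert _ _ _ _ _ hts hI, e1, e2, card_insert_of_notMem htI,
    prod_insert htI, prod_insert htI, prod_insert h3, prod_insert h3, h1, h2]
  ring

/-- The summand for `I` of the right-hand side of the recursion for sums of subset weights. -/
def recursionSummand (u : ℕ → ℂ) (a b : ℂ) (s I : Finset ℂ) (t : ℂ) : ℂ :=
  subsetWeight α β γ δ (fun z => a + b * z) s I *
    (u I.card * (1 + qInt (qParam α β γ δ) I.card * β * (γ + δ * t)) +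
      u (I.card + 1) * (a + b * t +
        qInt (qParam α β γ δ) (s.card - I.card) * (α + β * t) * (b * γ - a * δ)))

open Polynomial in
theorem sum_subsetWeight_insert_of_generic (u : ℕ → ℂ) (a b : ℂ) {s : Finset ℂ} {t : ℂ}
    (ht : t ∉ s) (hβ : β ≠ 0) (hδ : δ ≠ 0) (hαs : ∀ z ∈ s, α ≠ -(β * z))
    (hγs : ∀ z ∈ s, γ ≠ -(δ * z)) (hne : γ ≠ α * δ / β) :
    ∑ I ∈ (insert t s).powerset,
      u I.card * subsetWeight α β γ δ (fun z => a + b * z) (insert t s) I =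
      ∑ I ∈ s.powerset, recursionSummand α β γ δ u a b s I t := by
  set q := qParam α β γ δ with hqdef
  set e : Finset ℂ → ℂ := fun I => subsetWeight α β γ δ (fun z => a + b * z) s I with he
  -- As polynomials in `x`, `num1 j` is `-pairNumerator x j` and `num2 i` is `pairNumerator i x`.
  let num1 : ℂ → ℂ[X] := fun j => C (1 - α * δ - β * δ * j) * X - C (j + (α + β * j) * γ)
  let num2 : ℂ → ℂ[X] := fun i =>
    C (1 + β * (γ + δ * i)) * X + C (α * (γ + δ * i) - i)
  let P : ℂ[X] := ∑ I ∈ s.powerset,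
    (C (e I) * (C (u I.card) * ((∏ j ∈ I, num1 j) * ∏ i ∈ s \ I, (X - C i)) +
      C (u (I.card + 1)) * ((C b * X + C a) * ((∏ j ∈ I, (X - C j)) * ∏ i ∈ s \ I, num2 i)))
    - C (e I) * ((C (u I.card * (qInt q I.card * β * δ) + u (I.card + 1) * (b +
          qInt q (s.card - I.card) * β * (b * γ - a * δ))) * X +
        C (u I.card * (1 + qInt q I.card * β * γ) + u (I.card + 1) * (a +
          qInt q (s.card - I.card) * α * (b * γ - a * δ)))) * ∏ j ∈ s, (X - C j)))
  have hPeval : ∀ x, P.eval x = ∑ I ∈ s.powerset,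
      clearedSummand α β γ δ u (fun z => a + b * z) s I x -
      (∏ j ∈ s, (x - j)) * ∑ I ∈ s.powerset, recursionSummand α β γ δ u a b s I x := by
    intro x
    rw [mul_sum, ← sum_sub_distrib]
    simp only [P, eval_finsetSum]
    refine sum_congr rfl fun I _ => ?_
    have h1 : ∏ j ∈ I, (num1 j).eval x = ∏ j ∈ I, -pairNumerator α β γ δ x j :=
      prod_congr rfl fun j _ => by simp [num1, pairNumerator]; ring
    have h2 : ∏ j ∈ s \ I, (num2 j).eval x = ∏ j ∈ s \ I, pairNumerator α β γ δ j x :=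
      prod_congr rfl fun j _ => by simp [num2, pairNumerator]; ring
    simp only [eval_sub, eval_mul, eval_add, eval_C, eval_X, eval_prod, h1, h2, clearedSummand,
      recursionSummand, he, ← hqdef]
    ring
  have hdeg : P.natDegree ≤ s.card + 1 := by
    refine natDegree_sum_le_of_forall_le _ _ fun I hI => ?_
    have hI := mem_powerset.1 hI
    have hprod : ∀ (A : Finset ℂ) (F : ℂ → ℂ[X]), (∀ j, (F j).natDegree ≤ 1) →
        (∏ j ∈ A, F j).natDegree ≤ A.card := fun A F hF =>
      (natDegree_prod_le _ _).trans ((sum_le_sum fun j _ => hF j).trans (by simp))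
    have n1 : ∀ j, (num1 j).natDegree ≤ 1 := fun j => by
      simp only [num1]; compute_degree
    have n2 : ∀ j, (num2 j).natDegree ≤ 1 := fun j => by
      simp only [num2]; compute_degree
    have n3 : ∀ j : ℂ, (X - C j).natDegree ≤ 1 := fun j => by compute_degree
    have n4 : ∀ x y : ℂ, (C x * X + C y).natDegree ≤ 1 := fun x y => by compute_degree
    have hc : (s \ I).card + I.card = s.card := card_sdiff_add_card_eq_card hI
    have d1 : ((∏ j ∈ I, num1 j) * ∏ i ∈ s \ I, (X - C i)).natDegree ≤ s.card + 1 :=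
      (natDegree_mul_le_of_le (hprod I _ n1) (hprod (s \ I) _ n3)).trans (by omega)
    have d2 : ((C b * X + C a) * ((∏ j ∈ I, (X - C j)) * ∏ i ∈ s \ I, num2 i)).natDegree ≤
        s.card + 1 :=
      (natDegree_mul_le_of_le (n4 _ _)
        (natDegree_mul_le_of_le (hprod I _ n3) (hprod (s \ I) _ n2))).trans (by omega)
    have d3 : ∀ x y : ℂ, ((C x * X + C y) * ∏ j ∈ s, (X - C j)).natDegree ≤ s.card + 1 :=
      fun x y => (natDegree_mul_le_of_le (n4 _ _) (hprod s _ n3)).trans (by omega)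
    exact (natDegree_sub_le_of_le ((natDegree_C_mul_le _ _).trans
      (natDegree_add_le_of_degree_le ((natDegree_C_mul_le _ _).trans d1)
        ((natDegree_C_mul_le _ _).trans d2)))
      ((natDegree_C_mul_le _ _).trans (d3 _ _))).trans (max_self _).le
  have hs : ∀ x ∈ s, P.eval x = 0 := fun x hx => by
    rw [hPeval, sum_clearedSummand_eq_zero _ _ _ _ _ _ hx, prod_eq_zero hx (sub_self x)]; simp
  have hout : ∀ x, x ∉ s → P.eval x = (∏ j ∈ s, (x - j)) *
      (∑ I ∈ (insert x s).powerset,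
        u I.card * subsetWeight α β γ δ (fun z => a + b * z) (insert x s) I -
      ∑ I ∈ s.powerset, recursionSummand α β γ δ u a b s I x) := fun x hx => by
    rw [hPeval, ← prod_mul_sum_subsetWeight_insert _ _ _ _ _ _ hx]; ring
  have hq : q = 1 + β * γ - α * δ := rfl
  have hx1 : -(γ / δ) ∉ s := fun h => hγs _ h (by field_simp)
  have hx2 : -(α / β) ∉ s := fun h => hαs _ h (by field_simp)
  -- At `t = -γ/δ` the factors with `t` on the left are `1` and those with `t` on the right are `q`;
  -- at `t = -α/β` the roles are exchanged. In both cases the summands agree for each `I`.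
  have r1 : P.eval (-(γ / δ)) = 0 := by
    rw [hout _ hx1, sum_subsetWeight_insert _ _ _ _ _ _ hx1, ← sum_sub_distrib,
      sum_eq_zero, mul_zero]
    intro I hI
    have hI := mem_powerset.1 hI
    have hc : (s \ I).card = s.card - I.card := card_sdiff_of_subset hI
    have hroot : γ + δ * -(γ / δ) = 0 := by field_simp; ring
    rw [prod_congr rfl fun j _ => pairFactor_of_left_root hroot,
      prod_congr (s₁ := s \ I) rfl fun i hi => pairFactor_right_of_root
        (ne_of_mem_of_not_mem (mem_sdiff.1 hi).1 hx1) hroot, recursionSummand, prod_const,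
      prod_const, hc, hroot, ← hqdef]
    have := qInt_mul_sub q (s.card - I.card)
    have hab : (α + β * -(γ / δ)) * (b * γ - a * δ) = (q - 1) * (a + b * -(γ / δ)) := by
      rw [hq]; field_simp; ring
    linear_combination (-1) * subsetWeight α β γ δ (fun z => a + b * z) s I * u (I.card + 1) *
      (qInt q (s.card - I.card) * hab + (a + b * -(γ / δ)) * this)
  have r2 : P.eval (-(α / β)) = 0 := by
    rw [hout _ hx2, sum_subsetWeight_insert _ _ _ _ _ _ hx2, ← sum_sub_distrib,
      sum_eq_zero, mul_zero]
    intro I hI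
    have hI := mem_powerset.1 hI
    have hroot : α + β * -(α / β) = 0 := by field_simp; ring
    rw [prod_congr (s₁ := s \ I) rfl fun j _ => pairFactor_of_right_root hroot,
      prod_congr rfl fun i hi => pairFactor_left_of_root
        (ne_of_mem_of_not_mem (hI hi) hx2).symm hroot, recursionSummand, prod_const,
      prod_const, hroot, ← hqdef]
    have := qInt_mul_sub q I.card
    have hab : β * (γ + δ * -(α / β)) = q - 1 := by
      rw [hq]; field_simp; ring
    linear_combination (-1) * subsetWeight α β γ δ (fun z => a + b * z) s I * u I.card *
      (qInt q I.card * hab + this)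
  have hx12 : -(γ / δ) ≠ -(α / β) := fun h => hne (by field_simp at h ⊢; linear_combination -h)
  -- The degree is at most `|s| + 1`, and `|s| + 2` distinct roots are known.
  have hP : P = 0 := by
    refine eq_zero_of_natDegree_lt_card_of_eval_eq_zero' P
      (insert (-(γ / δ)) (insert (-(α / β)) s)) ?_ ?_
    · intro i hi
      rcases mem_insert.1 hi with rfl | hi
      · exact r1
      · rcases mem_insert.1 hi with rfl | hi
        · exact r2
        · exact hs _ hi
    · rw [card_insert_of_notMem (by simp [hx12, hx1]), card_insert_of_notMem hx2]
      omega
  have h0 := hout t ht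
  rw [hP, eval_zero] at h0
  rcases mul_eq_zero.1 h0.symm with h | h
  · obtain ⟨j, hj, hj0⟩ := prod_eq_zero_iff.1 h
    exact absurd (sub_eq_zero.1 hj0 ▸ hj) ht
  · exact sub_eq_zero.1 h

theorem eq_of_continuous_of_eq_off_finite {F G : ℂ → ℂ} (hF : Continuous F) (hG : Continuous G)
    {S : Set ℂ} (hS : S.Finite) (h : ∀ x, x ∉ S → F x = G x) (x : ℂ) : F x = G x :=
  congrFun (Continuous.ext_on (hS.countable.dense_compl ℂ) hF hG fun y hy => h y hy) x

/-- Both sides are continuous in the four parameters. Releasing them in the order `β`, `δ`, `α`, `γ`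
makes the set of excluded values finite at each stage. -/
theorem sum_subsetWeight_insert_eq (u : ℕ → ℂ) (a b : ℂ) {s : Finset ℂ} {t : ℂ} (ht : t ∉ s) :
    ∑ I ∈ (insert t s).powerset,
      u I.card * subsetWeight α β γ δ (fun z => a + b * z) (insert t s) I =
      ∑ I ∈ s.powerset, recursionSummand α β γ δ u a b s I t := by
  have hfin : ∀ c : ℂ, {x : ℂ | ∃ z ∈ s, x = -(c * z)}.Finite := fun c =>
    (s.finite_toSet.image fun z => -(c * z)).subset fun x ⟨z, hz, hx⟩ => ⟨z, hz, hx.symm⟩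
  let L : ℂ × ℂ × ℂ × ℂ → ℂ := fun x => ∑ I ∈ (insert t s).powerset, u I.card *
    subsetWeight x.1 x.2.1 x.2.2.1 x.2.2.2 (fun z => a + b * z) (insert t s) I
  let R : ℂ × ℂ × ℂ × ℂ → ℂ := fun x => ∑ I ∈ s.powerset,
    recursionSummand x.1 x.2.1 x.2.2.1 x.2.2.2 u a b s I t
  have hL : Continuous L := by
    simp only [L, subsetWeight, pairFactor]; fun_prop
  have hR : Continuous R := by
    simp only [R, recursionSummand, subsetWeight, pairFactor, qInt, qParam]; fun_prop
  refine eq_of_continuous_of_eq_off_finite (F := fun β' => L (α, β', γ, δ))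
    (G := fun β' => R (α, β', γ, δ)) (hL.comp (by fun_prop)) (hR.comp (by fun_prop))
    (Set.finite_singleton 0) (fun β' hβ => ?_) β
  refine eq_of_continuous_of_eq_off_finite (F := fun δ' => L (α, β', γ, δ'))
    (G := fun δ' => R (α, β', γ, δ')) (hL.comp (by fun_prop)) (hR.comp (by fun_prop))
    (Set.finite_singleton 0) (fun δ' hδ => ?_) δ
  refine eq_of_continuous_of_eq_off_finite (F := fun α' => L (α', β', γ, δ'))
    (G := fun α' => R (α', β', γ, δ')) (hL.comp (by fun_prop)) (hR.comp (by fun_prop))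
    (hfin β') (fun α' hα => ?_) α
  refine eq_of_continuous_of_eq_off_finite (F := fun γ' => L (α', β', γ', δ'))
    (G := fun γ' => R (α', β', γ', δ')) (hL.comp (by fun_prop)) (hR.comp (by fun_prop))
    ((hfin δ').union (Set.finite_singleton (α' * δ' / β'))) (fun γ' hγ => ?_) γ
  exact sum_subsetWeight_insert_of_generic α' β' γ' δ' u a b ht hβ hδ
    (fun z hz h => hα ⟨z, hz, h⟩) (fun z hz h => hγ (Or.inl ⟨z, hz, h⟩)) (fun h => hγ (Or.inr h))

theorem sum_prod_pairFactor_right (s : Finset ℂ) :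
    ∑ j ∈ s, ∏ i ∈ s.erase j, pairFactor α β γ δ i j = qInt (qParam α β γ δ) s.card := by
  have key : ∀ s : Finset ℂ, ∑ I ∈ s.powerset, (if I.card = 1 then (1 : ℂ) else 0) *
      subsetWeight α β γ δ (fun z => 1 + 0 * z) s I =
      ∑ j ∈ s, ∏ i ∈ s.erase j, pairFactor α β γ δ i j := fun s => by
    simp only [ite_mul, one_mul, zero_mul, ← sum_filter]
    rw [← powersetCard_eq_filter, powersetCard_one, sum_map]
    simp [subsetWeight, sdiff_singleton_eq_erase]
  induction s using Finset.induction_on with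
  | empty => simp [qInt_zero]
  | insert t s ht ih =>
    rw [← key] at ih ⊢
    rw [sum_subsetWeight_insert_eq _ _ _ _ (fun n => if n = 1 then 1 else 0) _ _ ht,
      card_insert_of_notMem ht, qInt_succ]
    have h : ∀ I ∈ s.powerset, recursionSummand α β γ δ (fun n => if n = 1 then 1 else 0) 1 0 s I t
        = (1 + β * (γ + δ * t)) * ((if I.card = 1 then (1 : ℂ) else 0) *
          subsetWeight α β γ δ (fun z => 1 + 0 * z) s I) +
          if I = ∅ then 1 - qInt (qParam α β γ δ) s.card * (α + β * t) * δ else 0 := by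
      intro I _
      rw [recursionSummand]
      rcases eq_or_ne I ∅ with rfl | hI
      · simp [subsetWeight_empty]; ring
      · have h2 : I.card ≠ 0 := by simpa using hI
        by_cases h1 : I.card = 1
        · simp [h1, hI, qInt_one]; ring
        · simp [h1, h2, hI]
    -- The point `t` drops out because `1 + β(γ + δt) - (α + βt)δ = q`, leaving `1 + q [m]`.
    rw [sum_congr rfl h, sum_add_distrib, ← mul_sum, ih, sum_ite_eq' _ _ fun _ => _]
    simp only [empty_mem_powerset, if_true, qParam]
    ring

/-- This substitution fixes `q`, so the identity for right arguments transfers to left arguments. -/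
theorem pairFactor_swap (u v : ℂ) : pairFactor (-γ) (-δ) α β u v = pairFactor α β γ δ v u := by
  rw [pairFactor, pairFactor, ← neg_sub u v, div_neg]; ring

theorem sum_prod_pairFactor_left (s : Finset ℂ) :
    ∑ i ∈ s, ∏ j ∈ s.erase i, pairFactor α β γ δ i j = qInt (qParam α β γ δ) s.card := by
  have h := sum_prod_pairFactor_right (-γ) (-δ) α β s
  simp only [pairFactor_swap] at h
  rw [h]; congr 1; simp only [qParam]; ring

/-- The coefficient of the sum over `r`-subsets in the expression of the first elementary symmetric
polynomial of `m` numbers. -/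
def subsetCoeff (m r : ℕ) : ℂ :=
  if r = 0 then 0 else (-(β * δ)) ^ (r - 1) * qFactorial (qParam α β γ δ) (r - 1) /
    ∏ a ∈ range r, (1 + β * γ * qInt (qParam α β γ δ) (m - 1 - a))

theorem subsetCoeff_one (m : ℕ) :
    subsetCoeff α β γ δ m 1 = (1 + β * γ * qInt (qParam α β γ δ) (m - 1))⁻¹ := by
  simp [subsetCoeff, qFactorial_zero]

theorem subsetCoeff_succ {m r : ℕ} (hr : r ≠ 0) :
    subsetCoeff α β γ δ m (r + 1) = subsetCoeff α β γ δ m r *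
      (-(β * δ) * qInt (qParam α β γ δ) r / (1 + β * γ * qInt (qParam α β γ δ) (m - 1 - r))) := by
  obtain ⟨r, rfl⟩ := Nat.exists_eq_succ_of_ne_zero hr
  simp only [subsetCoeff, Nat.succ_eq_add_one, Nat.add_eq_zero_iff, one_ne_zero, and_false,
    if_false, Nat.add_sub_cancel, qFactorial_succ, prod_range_succ _ (r + 1), pow_succ]
  rw [div_mul_div_comm]; ring

/-- The two denominators run over windows of consecutive `q`-integers shifted by one, so they differ
in one factor at each end. -/
theorem subsetCoeff_succ_left (hH : ∀ n : ℕ, 1 + β * γ * qInt (qParam α β γ δ) n ≠ 0)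
    {m r : ℕ} (hr : r ≠ 0) (hrm : r ≤ m) :
    subsetCoeff α β γ δ (m + 1) r * (1 + β * γ * qInt (qParam α β γ δ) m) =
      subsetCoeff α β γ δ m r * (1 + β * γ * qInt (qParam α β γ δ) (m - r)) := by
  obtain ⟨r, rfl⟩ := Nat.exists_eq_succ_of_ne_zero hr
  have e : (∏ a ∈ range (r + 1), (1 + β * γ * qInt (qParam α β γ δ) (m - a))) *
      (1 + β * γ * qInt (qParam α β γ δ) (m - (r + 1))) =
      (∏ a ∈ range (r + 1), (1 + β * γ * qInt (qParam α β γ δ) (m - 1 - a))) *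
      (1 + β * γ * qInt (qParam α β γ δ) m) := by
    rw [← prod_range_succ (fun a => 1 + β * γ * qInt (qParam α β γ δ) (m - a)), prod_range_succ']
    simp only [Nat.sub_zero]
    congr 1
    refine prod_congr rfl fun a _ => ?_
    rw [Nat.add_comm a 1, Nat.sub_add_eq]
  have n1 : ∀ m', ∏ a ∈ range (r + 1), (1 + β * γ * qInt (qParam α β γ δ) (m' - a)) ≠ 0 :=
    fun m' => prod_ne_zero_iff.2 fun _ _ => hH _
  simp only [subsetCoeff, Nat.succ_eq_add_one, Nat.add_eq_zero_iff, one_ne_zero, and_false,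
    if_false, Nat.add_sub_cancel]
  rw [div_mul_eq_mul_div, div_mul_eq_mul_div, div_eq_div_iff (n1 _) (n1 _)]
  linear_combination (-(β * δ)) ^ r * qFactorial (qParam α β γ δ) r * (-e)

/-- The coefficients are tuned so that, on adjoining `t`, every nonempty `I` keeps its contribution:
the terms in `t` cancel, and the constants match by `qInt_add` with `q - 1 = βγ - αδ`. The empty set
supplies exactly the new terms on the right. -/
theorem sum_subsetCoeff_mul_subsetWeight
    (hH : ∀ n : ℕ, 1 + β * γ * qInt (qParam α β γ δ) n ≠ 0) (s : Finset ℂ) :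
    ∑ I ∈ s.powerset, subsetCoeff α β γ δ s.card I.card * subsetWeight α β γ δ id s I =
      ∑ z ∈ s, z + α * γ * ∑ d ∈ range s.card,
        qInt (qParam α β γ δ) d / (1 + β * γ * qInt (qParam α β γ δ) d) := by
  have hid : (id : ℂ → ℂ) = fun z => 0 + 1 * z := by ext; simp
  induction s using Finset.induction_on with
  | empty => simp [subsetCoeff]
  | insert t s ht ih =>
    rw [hid] at ih ⊢
    rw [sum_subsetWeight_insert_eq _ _ _ _ (subsetCoeff α β γ δ _) _ _ ht,
      card_insert_of_notMem ht, sum_insert ht, sum_range_succ]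
    set q := qParam α β γ δ with hq
    set m := s.card with hm
    have h : ∀ I ∈ s.powerset, recursionSummand α β γ δ (subsetCoeff α β γ δ (m + 1)) 0 1 s I t
        = subsetCoeff α β γ δ m I.card * subsetWeight α β γ δ (fun z => 0 + 1 * z) s I +
          if I = ∅ then t + α * γ * (qInt q m / (1 + β * γ * qInt q m)) else 0 := by
      intro I hI
      have hIm : I.card ≤ m := card_le_card (mem_powerset.1 hI)
      have hHm := hH m
      rw [recursionSummand, ← hm, ← hq]
      rcases eq_or_ne I ∅ with rfl | hI
      · simp only [card_empty, zero_add, subsetCoeff_one, subsetWeight_empty, ← hq,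
          Nat.add_sub_cancel, Nat.sub_zero, if_true]
        simp only [subsetCoeff, if_true]
        field_simp; ring
      · have h0 : I.card ≠ 0 := by simpa using hI
        have h1 := subsetCoeff_succ_left α β γ δ hH h0 hIm
        have hn := hH (m - I.card)
        have ha := qInt_add q I.card (m - I.card)
        rw [Nat.add_sub_cancel' hIm] at ha
        rw [← hq] at h1
        rw [subsetCoeff_succ _ _ _ _ h0, ← hq, Nat.add_sub_cancel m 1, if_neg hI, add_zero,
          eq_div_of_mul_eq hn h1.symm]
        have hqe : q = 1 + β * γ - α * δ := rfl
        rw [ha]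
        set x := qInt q I.card
        set y := qInt q (m - I.card)
        field_simp
        rw [hqe]
        ring
    rw [sum_congr rfl h, sum_add_distrib, ih, sum_ite_eq' _ _ fun _ => _]
    simp only [empty_mem_powerset, if_true]
    ring

end subsets
-- Sums over orderings of a finite set.
section orderings

variable (f : ℂ → ℂ → ℂ)

/-- The sum over the orderings `z_1, …, z_n` of the elements of `s` of
`∏_{i < j} f z_i z_j * ∏_i g_i z_i`, where `g_1, …, g_n` is the given list. -/
def orderedSum : List (ℂ → ℂ) → Finset ℂ → ℂ
  | [], _ => 1
  | g :: gs, s => ∑ i ∈ s, g i * (∏ j ∈ s.erase i, f i j) * orderedSum gs (s.erase i)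

theorem sum_sum_powersetCard_erase {ι : Type*} [DecidableEq ι] (s : Finset ι) (n : ℕ)
    (F : ι → Finset ι → ℂ) :
    ∑ i ∈ s, ∑ T ∈ powersetCard n (s.erase i), F i T =
      ∑ T ∈ powersetCard (n + 1) s, ∑ i ∈ T, F i (T.erase i) := by
  rw [sum_sigma', sum_sigma']
  refine sum_bij' (fun x _ => ⟨insert x.1 x.2, x.1⟩) (fun x _ => ⟨x.2, x.1.erase x.2⟩) ?_ ?_ ?_ ?_ ?_
  · rintro ⟨i, T⟩ h
    simp only [mem_sigma, mem_powersetCard, mem_insert_self, and_true] at h ⊢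
    have hi : i ∉ T := fun hi => notMem_erase i s (h.2.1 hi)
    exact ⟨insert_subset h.1 (h.2.1.trans (erase_subset _ _)), by
      rw [card_insert_of_notMem hi, h.2.2]⟩
  · rintro ⟨T, i⟩ h
    simp only [mem_sigma, mem_powersetCard] at h ⊢
    exact ⟨h.1.1 h.2, erase_subset_erase _ h.1.1, by rw [card_erase_of_mem h.2, h.1.2]; rfl⟩
  · rintro ⟨i, T⟩ h
    simp only [mem_sigma, mem_powersetCard] at h
    have hi : i ∉ T := fun hi => notMem_erase i s (h.2.1 hi)
    simp [erase_insert hi]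
  · rintro ⟨T, i⟩ h
    simp only [mem_sigma] at h
    simp [insert_erase h.2]
  · rintro ⟨i, T⟩ h
    simp only [mem_sigma, mem_powersetCard] at h
    have hi : i ∉ T := fun hi => notMem_erase i s (h.2.1 hi)
    simp [erase_insert hi]

/-- `T` is the set of elements in the first `A.length` places; the factors between `T` and its
complement do not depend on the orderings of either. -/
theorem orderedSum_append (A B : List (ℂ → ℂ)) (s : Finset ℂ) :
    orderedSum f (A ++ B) s = ∑ T ∈ powersetCard A.length s,
      orderedSum f A T * (∏ i ∈ T, ∏ j ∈ s \ T, f i j) * orderedSum f B (s \ T) := by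
  induction A generalizing s with
  | nil => simp [orderedSum]
  | cons g gs ih =>
    simp only [List.cons_append, orderedSum, List.length_cons, ih, mul_sum]
    rw [sum_sum_powersetCard_erase]
    refine sum_congr rfl fun T hT => ?_
    have hT := (mem_powersetCard.1 hT).1
    rw [sum_mul, sum_mul]
    refine sum_congr rfl fun i hi => ?_
    have e1 : s.erase i \ T.erase i = s \ T := by
      ext x; simp only [mem_sdiff, mem_erase]; grind
    have e2 : s.erase i \ T = s \ T := by
      ext x; simp only [mem_sdiff, mem_erase]; grind
    rw [e1, ← prod_sdiff (erase_subset_erase i hT), e1, ← mul_prod_erase T _ hi]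
    ring

theorem orderedSum_map_mul (h : ℂ → ℂ) (l : List (ℂ → ℂ)) (s : Finset ℂ) (hs : s.card = l.length) :
    orderedSum f (l.map fun g z => h z * g z) s = (∏ z ∈ s, h z) * orderedSum f l s := by
  induction l generalizing s with
  | nil => simp at hs; simp [orderedSum, hs]
  | cons g gs ih =>
    simp only [List.map_cons, orderedSum, mul_sum]
    refine sum_congr rfl fun i hi => ?_
    rw [ih _ (by rw [card_erase_of_mem hi, hs]; rfl), ← mul_prod_erase s _ hi]
    ring

theorem orderedSum_ofFn {n : ℕ} (p : Fin n → ℂ) (hp : Function.Injective p) (g : Fin n → ℂ → ℂ) :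
    ∑ σ : Equiv.Perm (Fin n), (∏ i, ∏ j ∈ Ioi i, f (p (σ i)) (p (σ j))) * ∏ i, g i (p (σ i)) =
      orderedSum f (List.ofFn g) (univ.image p) := by
  induction n with
  | zero => simp [orderedSum]
  | succ n ih =>
    rw [List.ofFn_succ, orderedSum, sum_image hp.injOn,
      Fintype.sum_equiv Equiv.Perm.decomposeFin _
        (fun x => (∏ i, ∏ j ∈ Ioi i, f (p (Equiv.Perm.decomposeFin.symm x i))
          (p (Equiv.Perm.decomposeFin.symm x j))) *
          ∏ i, g i (p (Equiv.Perm.decomposeFin.symm x i))) (fun σ => by simp),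
      Fintype.sum_prod_type]
    refine sum_congr rfl fun a _ => ?_
    -- `a` is the value of the permutation at `0`, and `p'` enumerates the parameters other than `p
    -- a`.
    set p' : Fin n → ℂ := fun i => p (Equiv.swap 0 a i.succ) with hp'
    have hp'i : Function.Injective p' := fun i j h =>
      Fin.succ_injective _ ((Equiv.swap 0 a).injective (hp h))
    have him : univ.image p' = (univ.image p).erase (p a) := by
      ext z
      simp only [mem_image, mem_univ, true_and, mem_erase]
      constructor
      · rintro ⟨i, rfl⟩
        refine ⟨fun h => ?_, _, rfl⟩
        have h2 := hp h
        rw [Equiv.swap_apply_eq_iff, Equiv.swap_apply_right] at h2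
        exact Fin.succ_ne_zero i h2
      · rintro ⟨hz, i, rfl⟩
        have h0 : Equiv.swap 0 a i ≠ 0 := fun h => hz (by
          rw [Equiv.swap_apply_eq_iff, Equiv.swap_apply_left] at h; rw [h])
        obtain ⟨j, hj⟩ := Fin.exists_succ_eq.2 h0
        exact ⟨j, by rw [hp']; simp [hj]⟩
    rw [← him, ← ih p' hp'i (fun i => g i.succ), mul_sum]
    refine sum_congr rfl fun e _ => ?_
    have hprod : ∏ x ∈ univ.image p', f (p a) x = ∏ i, f (p a) (p' (e i)) := by
      rw [prod_image hp'i.injOn]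
      exact (Equiv.prod_comp e fun i => f (p a) (p' i)).symm
    rw [Fin.prod_univ_succ, Fin.prod_univ_succ, Fin.prod_Ioi_zero, hprod]
    simp only [Fin.prod_Ioi_succ, Equiv.Perm.decomposeFin_symm_apply_zero,
      Equiv.Perm.decomposeFin_symm_apply_succ, hp']
    ring

end orderings

/-! ### Ordered sums with power weights, and the eigenvalue equation on one level. -/

variable (α β γ δ : ℂ)

theorem orderedSum_replicate_one (s : Finset ℂ) :
    orderedSum (pairFactor α β γ δ) (List.replicate s.card fun _ => 1) s =
      qFactorial (qParam α β γ δ) s.card := by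
  generalize hn : s.card = n
  induction n generalizing s with
  | zero => simp [orderedSum, qFactorial_zero]
  | succ n ih =>
    rw [List.replicate_succ, orderedSum, qFactorial_succ, ← hn, ← sum_prod_pairFactor_left, mul_sum]
    refine sum_congr rfl fun i hi => ?_
    rw [ih _ (by rw [card_erase_of_mem hi, hn]; rfl)]
    ring

/-- The ordered sum with the weights `z ^ (-n)`, `n` in the list. -/
def powerSum (l : List ℤ) (s : Finset ℂ) : ℂ :=
  orderedSum (pairFactor α β γ δ) (l.map fun (n : ℤ) (z : ℂ) => z ^ (-n)) s

theorem powerSum_append (A B : List ℤ) (s : Finset ℂ) :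
    powerSum α β γ δ (A ++ B) s = ∑ T ∈ powersetCard A.length s,
      powerSum α β γ δ A T * (∏ i ∈ T, ∏ j ∈ s \ T, pairFactor α β γ δ i j) *
        powerSum α β γ δ B (s \ T) := by
  simp [powerSum, orderedSum_append]

theorem powerSum_replicate (c : ℤ) (s : Finset ℂ) :
    powerSum α β γ δ (List.replicate s.card c) s =
      (∏ z ∈ s, z ^ (-c)) * qFactorial (qParam α β γ δ) s.card := by
  rw [← orderedSum_replicate_one, ← orderedSum_map_mul _ _ _ _ (by simp)]
  simp [powerSum]

theorem powerSum_replicate_append_replicate (c : ℤ) {s : Finset ℂ} (h0 : (0 : ℂ) ∉ s) {r : ℕ}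
    (hr : r ≤ s.card) :
    powerSum α β γ δ (List.replicate (s.card - r) c ++ List.replicate r (c - 1)) s =
      qFactorial (qParam α β γ δ) r * qFactorial (qParam α β γ δ) (s.card - r) *
        (∏ z ∈ s, z ^ (-c)) * ∑ I ∈ powersetCard r s, subsetWeight α β γ δ id s I := by
  rw [powerSum_append, List.length_replicate, mul_sum]
  -- The first block gets `T`, so the lowered exponents fall on the complement `I = s \ T`.
  refine sum_bij' (fun T _ => s \ T) (fun T _ => s \ T) ?_ ?_ ?_ ?_ ?_
  · intro T hT
    have hT := mem_powersetCard.1 hT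
    exact mem_powersetCard.2 ⟨sdiff_subset, by rw [card_sdiff_of_subset hT.1]; omega⟩
  · intro T hT
    have hT := mem_powersetCard.1 hT
    exact mem_powersetCard.2 ⟨sdiff_subset, by rw [card_sdiff_of_subset hT.1]; omega⟩
  · exact fun T hT => Finset.sdiff_sdiff_eq_self (mem_powersetCard.1 hT).1
  · exact fun T hT => Finset.sdiff_sdiff_eq_self (mem_powersetCard.1 hT).1
  · intro T hT
    have hT := mem_powersetCard.1 hT
    have hc : (s \ T).card = r := by rw [card_sdiff_of_subset hT.1]; omega
    have e1 := powerSum_replicate α β γ δ c T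
    have e2 := powerSum_replicate α β γ δ (c - 1) (s \ T)
    rw [hT.2] at e1
    rw [hc] at e2
    have e3 : ∏ z ∈ s \ T, z ^ (-(c - 1)) = (∏ z ∈ s \ T, z ^ (-c)) * ∏ z ∈ s \ T, z := by
      rw [← prod_mul_distrib]
      refine prod_congr rfl fun z hz => ?_
      have hz0 : z ≠ 0 := fun h => h0 (h ▸ (mem_sdiff.1 hz).1)
      rw [neg_sub, sub_eq_neg_add, zpow_add₀ hz0, zpow_one]
    rw [e1, e2, e3, subsetWeight, Finset.sdiff_sdiff_eq_self hT.1, prod_mul_distrib, prod_comm (s := T),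
      ← prod_sdiff hT.1 (f := fun z => z ^ (-c))]
    simp only [id]
    ring

/-- The sum of `q ^ (∑ i ∈ J, #{p ∈ B, p < i})` over the `r`-subsets `J` of a set `B` with `m`
elements, which depends on `r` and `m` only. -/
def rankSum (q : ℂ) : ℕ → ℕ → ℂ
  | 0, _ => 1
  | _ + 1, 0 => 0
  | r + 1, m + 1 => rankSum q (r + 1) m + q ^ m * rankSum q r m

/-- The `q`-binomial formula, kept free of division since `q`-factorials may vanish; it follows from
the `q`-Pascal rule. -/
theorem rankSum_mul (q : ℂ) (r n : ℕ) :
    rankSum q r (r + n) * (qFactorial q r * qFactorial q n) =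
      q ^ (r * (r - 1) / 2) * qFactorial q (r + n) := by
  have h0 : ∀ r m, m < r → rankSum q r m = 0 := by
    intro r m h
    induction m generalizing r with
    | zero => obtain ⟨r, rfl⟩ := Nat.exists_eq_succ_of_ne_zero h.ne'; simp [rankSum]
    | succ m ih =>
      obtain ⟨r, rfl⟩ := Nat.exists_eq_succ_of_ne_zero (Nat.ne_zero_of_lt h)
      rw [rankSum, ih _ (by omega), ih _ (by omega)]; simp
  induction r generalizing n with
  | zero => simp [rankSum, qFactorial_zero]
  | succ r ihr =>
    have hC : (r + 1) * (r + 1 - 1) / 2 = r * (r - 1) / 2 + r := by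
      rw [← Nat.choose_two_right, ← Nat.choose_two_right, Nat.choose_succ_succ' r 1]
      simp [add_comm]
    rw [hC]
    induction n with
    | zero =>
      have h := ihr 0
      simp only [Nat.add_zero] at h ⊢
      rw [rankSum, h0 _ _ (Nat.lt_succ_self r), qFactorial_succ, pow_add]
      linear_combination q ^ r * qInt q (r + 1) * h
    | succ n ihn =>
      have h := ihr (n + 1)
      have e : r + 1 + (n + 1) = (r + (n + 1)) + 1 := by omega
      have e' : r + 1 + n = r + (n + 1) := by omega
      have hq : qInt q (r + (n + 1) + 1) = qInt q (n + 1) + q ^ (n + 1) * qInt q (r + 1) := by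
        rw [show r + (n + 1) + 1 = n + 1 + (r + 1) by omega, qInt_add]
        linear_combination qInt q (r + 1) * qInt_mul_sub q (n + 1)
      rw [e'] at ihn
      rw [e, rankSum, qFactorial_succ q n, qFactorial_succ q (r + (n + 1)), hq, pow_add q _ r,
        qFactorial_succ q r]
      rw [qFactorial_succ q n] at h
      rw [qFactorial_succ q r] at ihn
      have : q ^ (r + (n + 1)) = q ^ r * q ^ (n + 1) := pow_add _ _ _
      rw [this]
      rw [pow_add q _ r] at ihn
      linear_combination qInt q (n + 1) * ihn + q ^ r * q ^ (n + 1) * qInt q (r + 1) * h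

/-- A new maximum has rank `|B|` and leaves the other ranks unchanged, which is the recursion of
`rankSum`. -/
theorem sum_pow_rank {ι : Type*} [LinearOrder ι] (q : ℂ) (r : ℕ) (B : Finset ι) :
    ∑ J ∈ powersetCard r B, q ^ (∑ i ∈ J, (B.filter (· < i)).card) = rankSum q r B.card := by
  induction B using Finset.induction_on_max generalizing r with
  | empty => cases r <;> simp [rankSum]
  | insert a B ha ih =>
    have haB : a ∉ B := fun h => lt_irrefl _ (ha a h)
    cases r with
    | zero => simp [rankSum]
    | succ r =>
      have hlt : ∀ i ∈ B, ((insert a B).filter (· < i)) = B.filter (· < i) := fun i hi => by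
        rw [filter_insert, if_neg (ha i hi).not_gt]
      have hle : (insert a B).filter (· < a) = B := by
        rw [filter_insert, if_neg (lt_irrefl _), filter_true_of_mem ha]
      rw [powersetCard_succ_insert haB, sum_union, sum_image, card_insert_of_notMem haB, rankSum,
        ← ih, ← ih, mul_sum]
      · congr 1
        · refine sum_congr rfl fun J hJ => ?_
          rw [sum_congr rfl fun i hi => by rw [hlt i ((mem_powersetCard.1 hJ).1 hi)]]
        · refine sum_congr rfl fun J hJ => ?_
          have hJ := (mem_powersetCard.1 hJ).1
          rw [sum_insert fun h => haB (hJ h), hle,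
            sum_congr rfl fun i hi => by rw [hlt i (hJ hi)], pow_add]
      · intro I hI J hJ h
        have hI := (mem_powersetCard.1 hI).1
        have hJ := (mem_powersetCard.1 hJ).1
        simpa [erase_insert fun h => haB (hI h), erase_insert fun h => haB (hJ h)] using
          congrArg (fun K => K.erase a) h
      · rw [disjoint_left]
        intro J hJ h
        obtain ⟨K, _, rfl⟩ := mem_image.1 h
        exact haB ((mem_powersetCard.1 hJ).1 (mem_insert_self _ _))

theorem sum_comp_corank {ι : Type*} [LinearOrder ι] (G : ℕ → ℂ) (B : Finset ι) :
    ∑ j ∈ B, G (B.filter (j < ·)).card = ∑ d ∈ range B.card, G d := by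
  induction B using Finset.induction_on_min with
  | empty => simp
  | insert a B ha ih =>
    have haB : a ∉ B := fun h => lt_irrefl _ (ha a h)
    rw [sum_insert haB, card_insert_of_notMem haB, sum_range_succ, ← ih, filter_insert,
      if_neg (lt_irrefl _), filter_true_of_mem ha, add_comm]
    congr 1
    refine sum_congr rfl fun i hi => ?_
    rw [filter_insert, if_neg (ha i hi).not_gt]

/-- The coefficient with which the discrete Hamiltonian lowers `r` of `m` equal coordinates. -/
def lowerCoeff (m r : ℕ) : ℂ :=
  (-(β * δ)) ^ (r - 1) * qFactorial (qParam α β γ δ) (r - 1) *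
    (qParam α β γ δ ^ (r * (r - 1) / 2))⁻¹ * rankSum (qParam α β γ δ) r m /
    ∏ a ∈ range r, (1 + β * γ * qInt (qParam α β γ δ) (m - 1 - a))

theorem lowerCoeff_mul (hq : qParam α β γ δ ≠ 0) {m r : ℕ} (hr : r ≠ 0) (hrm : r ≤ m) :
    lowerCoeff α β γ δ m r *
      (qFactorial (qParam α β γ δ) r * qFactorial (qParam α β γ δ) (m - r)) =
      qFactorial (qParam α β γ δ) m * subsetCoeff α β γ δ m r := by
  have h := rankSum_mul (qParam α β γ δ) r (m - r)
  rw [Nat.add_sub_cancel' hrm] at h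
  have hq' := pow_ne_zero (r * (r - 1) / 2) hq
  rw [lowerCoeff, subsetCoeff, if_neg hr, div_mul_eq_mul_div, mul_assoc, h]
  field_simp

theorem lowerCoeff_of_lt {m r : ℕ} (h : m < r) : lowerCoeff α β γ δ m r = 0 := by
  have h0 := sum_pow_rank (qParam α β γ δ) r (range m)
  rw [powersetCard_eq_empty.2 (by simpa using h), sum_empty, card_range] at h0
  simp [lowerCoeff, ← h0]

/-- The diagonal part of the discrete Hamiltonian for `m` equal coordinates. -/
def diagCoeff (m : ℕ) : ℂ :=
  ∑ d ∈ range m, qInt (qParam α β γ δ) d / (1 + β * γ * qInt (qParam α β γ δ) d)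

theorem sum_lowerCoeff_mul_powerSum (hq : qParam α β γ δ ≠ 0)
    (hH : ∀ n : ℕ, 1 + β * γ * qInt (qParam α β γ δ) n ≠ 0) (c : ℤ) {s : Finset ℂ}
    (h0 : (0 : ℂ) ∉ s) :
    -(α * γ) * diagCoeff α β γ δ s.card * powerSum α β γ δ (List.replicate s.card c) s +
      ∑ r ∈ range s.card, lowerCoeff α β γ δ s.card (r + 1) *
        powerSum α β γ δ
          (List.replicate (s.card - (r + 1)) c ++ List.replicate (r + 1) (c - 1)) s =
      (∑ z ∈ s, z) * powerSum α β γ δ (List.replicate s.card c) s := by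
  have h := sum_subsetCoeff_mul_subsetWeight α β γ δ hH s
  rw [sum_powerset, sum_range_succ'] at h
  have h2 : ∀ r ∈ range s.card, lowerCoeff α β γ δ s.card (r + 1) * powerSum α β γ δ
      (List.replicate (s.card - (r + 1)) c ++ List.replicate (r + 1) (c - 1)) s =
      powerSum α β γ δ (List.replicate s.card c) s * ∑ I ∈ powersetCard (r + 1) s,
        subsetCoeff α β γ δ s.card I.card * subsetWeight α β γ δ id s I := by
    intro r hr
    have hr : r + 1 ≤ s.card := mem_range.1 hr
    have h3 := lowerCoeff_mul α β γ δ hq (Nat.succ_ne_zero r) hr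
    have h4 : ∑ I ∈ powersetCard (r + 1) s,
        subsetCoeff α β γ δ s.card I.card * subsetWeight α β γ δ id s I =
        subsetCoeff α β γ δ s.card (r + 1) *
          ∑ I ∈ powersetCard (r + 1) s, subsetWeight α β γ δ id s I := by
      rw [mul_sum]
      exact sum_congr rfl fun I hI => by rw [(mem_powersetCard.1 hI).2]
    rw [powerSum_replicate_append_replicate _ _ _ _ _ h0 hr, powerSum_replicate, h4]
    linear_combination (∏ z ∈ s, z ^ (-c)) *
      (∑ I ∈ powersetCard (r + 1) s, subsetWeight α β γ δ id s I) * h3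
  rw [sum_congr rfl h2, ← mul_sum]
  simp only [powersetCard_zero, sum_singleton, card_empty, subsetCoeff, if_true, zero_mul,
    add_zero] at h
  simp only [subsetCoeff, h, diagCoeff]
  ring

/-! ### Assembling the levels of a decreasing list. -/

/-- The list obtained from a weakly decreasing list `l` by lowering the last `r` of the entries `c`
by `1`. -/
def lowered (c : ℤ) (r : ℕ) (l : List ℤ) : List ℤ :=
  l.filter (c < ·) ++ (List.replicate (l.count c - r) c ++ List.replicate r (c - 1)) ++
    l.filter (· < c)

theorem lowered_zero (c : ℤ) {l : List ℤ} (hl : l.SortedGE) : lowered c 0 l = l := by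
  refine List.Perm.eq_of_pairwise' (r := (· ≥ ·)) ?_ hl.pairwise (List.perm_iff_count.2 fun a => ?_)
  · simp only [lowered, List.pairwise_append, List.mem_append, List.mem_filter, decide_eq_true_eq,
      List.mem_replicate, List.pairwise_replicate, List.replicate_zero, List.append_nil]
    refine ⟨⟨hl.pairwise.filter _, by simp, ?_⟩, hl.pairwise.filter _, ?_⟩ <;> grind
  · have h : ∀ P : ℤ → Bool, (l.filter P).count a = if P a then l.count a else 0 := fun P => by
      split_ifs with hP
      · exact List.count_filter hP
      · exact List.count_eq_zero_of_not_mem fun h => hP (List.mem_filter.1 h).2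
    simp only [lowered, List.count_append, List.count_replicate, h, decide_eq_true_eq, beq_iff_eq]
    rcases lt_trichotomy a c with hac | rfl | hac
    · simp [hac, hac.not_gt, hac.ne']
    · simp
    · simp [hac, hac.not_gt, hac.ne]

/-- Order survives because integers below `c` are at most `c - 1`. Hence the Bethe sum applies at
the lowered point. -/
theorem lowered_sortedGE (c : ℤ) (r : ℕ) {l : List ℤ} (hl : l.SortedGE) :
    (lowered c r l).Pairwise (· ≥ ·) := by
  simp only [lowered, List.pairwise_append, List.mem_append, List.mem_filter, decide_eq_true_eq,
    List.mem_replicate, List.pairwise_replicate]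
  refine ⟨⟨hl.pairwise.filter _, ⟨by simp, by simp, ?_⟩, ?_⟩, hl.pairwise.filter _, ?_⟩ <;> grind

theorem lowered_replicate_append_self (c : ℤ) (r m : ℕ) {l : List ℤ} (hl : ∀ n ∈ l, n < c) :
    lowered c r (List.replicate m c ++ l) =
      (List.replicate (m - r) c ++ List.replicate r (c - 1)) ++ l := by
  have h1 : l.filter (c < ·) = [] := List.filter_eq_nil_iff.2 fun n hn => by
    simpa using (hl n hn).le
  have h2 : l.filter (· < c) = l := List.filter_eq_self.2 fun n hn => by simpa using hl n hn
  have h3 : l.count c = 0 := List.count_eq_zero_of_not_mem fun h => lt_irrefl _ (hl c h)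
  simp [lowered, h1, h2, h3]

theorem lowered_replicate_append_of_lt {c c' : ℤ} (h : c' < c) (r m : ℕ) (l : List ℤ) :
    lowered c' r (List.replicate m c ++ l) = List.replicate m c ++ lowered c' r l := by
  have h3 : (List.replicate m c).count c' = 0 := by
    simp [List.count_replicate, h.ne']
  simp [lowered, h, h.not_gt, h3]

theorem coe_lowered_add (c : ℤ) {r : ℕ} {l : List ℤ} (hl : l.SortedGE) (hr : r ≤ l.count c) :
    (lowered c r l : Multiset ℤ) + Multiset.replicate r c =
      (l : Multiset ℤ) + Multiset.replicate r (c - 1) := by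
  have h : (l : Multiset ℤ) = (lowered c 0 l : Multiset ℤ) := by rw [lowered_zero c hl]
  have h2 : Multiset.replicate (l.count c) c =
      Multiset.replicate (l.count c - r) c + Multiset.replicate r c := by
    rw [← Multiset.replicate_add, Nat.sub_add_cancel hr]
  rw [h]
  simp only [lowered, ← Multiset.coe_add, Multiset.coe_replicate, h2, Nat.sub_zero,
    Multiset.replicate_zero, add_zero]
  abel

/-- The contribution of the coordinates equal to `c` to the action of the discrete Hamiltonian. -/
def levelTerm (c : ℤ) (l : List ℤ) (s : Finset ℂ) : ℂ :=
  -(α * γ) * diagCoeff α β γ δ (l.count c) * powerSum α β γ δ l s +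
    ∑ r ∈ range (l.count c), lowerCoeff α β γ δ (l.count c) (r + 1) *
      powerSum α β γ δ (lowered c (r + 1) l) s

theorem levelTerm_replicate_append_self (hq : qParam α β γ δ ≠ 0)
    (hH : ∀ n : ℕ, 1 + β * γ * qInt (qParam α β γ δ) n ≠ 0) {c : ℤ} (m : ℕ) {l : List ℤ}
    (hl : ∀ n ∈ l, n < c) {s : Finset ℂ} (h0 : (0 : ℂ) ∉ s) :
    levelTerm α β γ δ c (List.replicate m c ++ l) s = ∑ T ∈ powersetCard m s,
      (∑ z ∈ T, z) * (powerSum α β γ δ (List.replicate m c) T *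
        (∏ i ∈ T, ∏ j ∈ s \ T, pairFactor α β γ δ i j) * powerSum α β γ δ l (s \ T)) := by
  have h3 : l.count c = 0 := List.count_eq_zero_of_not_mem fun h => lt_irrefl _ (hl c h)
  have hc : (List.replicate m c ++ l).count c = m := by simp [h3]
  rw [levelTerm, hc]
  have h : ∀ r ∈ range m, lowerCoeff α β γ δ m (r + 1) *
      powerSum α β γ δ (lowered c (r + 1) (List.replicate m c ++ l)) s =
      ∑ T ∈ powersetCard m s, lowerCoeff α β γ δ m (r + 1) * (powerSum α β γ δ
        (List.replicate (m - (r + 1)) c ++ List.replicate (r + 1) (c - 1)) T *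
        (∏ i ∈ T, ∏ j ∈ s \ T, pairFactor α β γ δ i j) * powerSum α β γ δ l (s \ T)) := by
    intro r hr
    have hr : r + 1 ≤ m := mem_range.1 hr
    rw [lowered_replicate_append_self _ _ _ hl, powerSum_append, mul_sum]
    have : (List.replicate (m - (r + 1)) c ++ List.replicate (r + 1) (c - 1)).length = m := by
      simp only [List.length_append, List.length_replicate]; omega
    rw [this]
  rw [sum_congr rfl h, sum_comm, powerSum_append, List.length_replicate, mul_sum,
    ← sum_add_distrib]
  refine sum_congr rfl fun T hT => ?_
  have hT := mem_powersetCard.1 hT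
  have key := sum_lowerCoeff_mul_powerSum α β γ δ hq hH c fun h => h0 (hT.1 h)
  rw [hT.2] at key
  rw [← mul_assoc, ← mul_assoc, ← mul_assoc, ← mul_assoc, ← key, add_mul, add_mul, sum_mul, sum_mul]
  congr 1
  exact sum_congr rfl fun r _ => by ring

theorem levelTerm_replicate_append_of_lt {c c' : ℤ} (h : c' < c) (m : ℕ) (l : List ℤ)
    (s : Finset ℂ) :
    levelTerm α β γ δ c' (List.replicate m c ++ l) s = ∑ T ∈ powersetCard m s,
      powerSum α β γ δ (List.replicate m c) T *
        (∏ i ∈ T, ∏ j ∈ s \ T, pairFactor α β γ δ i j) * levelTerm α β γ δ c' l (s \ T) := by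
  have hc : (List.replicate m c ++ l).count c' = l.count c' := by
    simp [List.count_replicate, h.ne']
  simp only [levelTerm, hc, lowered_replicate_append_of_lt h, powerSum_append,
    List.length_replicate, mul_sum]
  rw [sum_comm, ← sum_add_distrib]
  refine sum_congr rfl fun T _ => ?_
  rw [mul_add, mul_sum]
  congr 1
  · ring
  · exact sum_congr rfl fun r _ => by ring

theorem sum_levelTerm (hq : qParam α β γ δ ≠ 0)
    (hH : ∀ n : ℕ, 1 + β * γ * qInt (qParam α β γ δ) n ≠ 0) (l : List ℤ) (hl : l.SortedGE)
    (s : Finset ℂ) (hs : s.card = l.length) (h0 : (0 : ℂ) ∉ s) :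
    ∑ c ∈ l.toFinset, levelTerm α β γ δ c l s = (∑ z ∈ s, z) * powerSum α β γ δ l s := by
  induction hn : l.length using Nat.strong_induction_on generalizing l s with
  | _ n ih =>
  rcases l with _ | ⟨c, l'⟩
  · simp at hs; simp [hs]
  · set l := c :: l' with hldef
    have hmax : ∀ a ∈ l, a ≤ c := by
      intro a ha
      rcases List.mem_cons.1 ha with rfl | ha
      · rfl
      · exact List.rel_of_pairwise_cons hl.pairwise ha
    -- The whole top level is split off. It contributes `∑_{z ∈ T} z`, and the lower levels
    -- contribute the sum over `s \ T` by induction.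
    obtain ⟨m, lo, hm, hlo, hle⟩ : ∃ m lo, 0 < m ∧ (∀ n ∈ lo, n < c) ∧
        l = List.replicate m c ++ lo := by
      refine ⟨l.count c, l.filter (· < c), by simp [hldef], by simp, ?_⟩
      conv_lhs => rw [← lowered_zero c hl]
      have : l.filter (c < ·) = [] := List.filter_eq_nil_iff.2 fun n hn => by
        simpa using hmax n hn
      simp [lowered, this]
    clear_value l
    subst hle
    have hlo' : lo.SortedGE := (List.pairwise_append.1 hl.pairwise).2.1.sortedGE
    simp only [List.length_append, List.length_replicate] at hs hn
    have hfin : (List.replicate m c ++ lo).toFinset = insert c lo.toFinset := by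
      ext a; simp only [List.mem_toFinset, List.mem_append, List.mem_replicate, mem_insert]; grind
    have hc : c ∉ lo.toFinset := fun h => lt_irrefl _ (hlo c (List.mem_toFinset.1 h))
    rw [hfin, sum_insert hc, levelTerm_replicate_append_self _ _ _ _ hq hH m hlo h0,
      sum_congr rfl fun c' hc' => levelTerm_replicate_append_of_lt α β γ δ
        (hlo c' (List.mem_toFinset.1 hc')) m lo s, sum_comm, ← sum_add_distrib, powerSum_append,
      List.length_replicate, mul_sum]
    refine sum_congr rfl fun T hT => ?_
    have hT := mem_powersetCard.1 hT
    rw [← mul_sum, ih lo.length (by omega) lo hlo' (s \ T)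
      (by rw [card_sdiff_of_subset hT.1]; omega) (fun h => h0 (mem_sdiff.1 h).1) rfl,
      ← sum_sdiff hT.1]
    ring

/-! ### From the lattice function and `H` to lists and levels. -/

section function

variable {k : ℕ}

theorem betheSum_eq_powerSum {p : Fin k → ℂ} (hp : Function.Injective p) (x : Lattice k) :
    betheSum α β γ δ p x = powerSum α β γ δ (List.ofFn x) (univ.image p) := by
  rw [powerSum, List.map_ofFn, ← orderedSum_ofFn _ _ hp]
  rfl

theorem ofFn_dominantRep_eq {x : Lattice k} {l : List ℤ} (hl : l.SortedGE)
    (hx : (l : Multiset ℤ) = univ.val.map x) : List.ofFn (dominantRep x) = l := by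
  refine List.Perm.eq_of_sortedGE (Antitone.sortedGE_ofFn (dominantRep_mem x)) hl ?_
  refine (Equiv.Perm.ofFn_comp_perm (Tuple.sort fun j => -x j) x).trans ?_
  rw [← Multiset.coe_eq_coe, hx, Fin.univ_val_map]

theorem betheFunction_eq_powerSum {p : Fin k → ℂ} (hp : Function.Injective p) {x : Lattice k}
    {l : List ℤ} (hl : l.SortedGE) (hx : (l : Multiset ℤ) = univ.val.map x) :
    betheFunction α β γ δ p x = powerSum α β γ δ l (univ.image p) := by
  rw [betheFunction, betheSum_eq_powerSum _ _ _ _ hp, ofFn_dominantRep_eq hl hx]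

theorem coe_ofFn_dominantRep (x : Lattice k) :
    (List.ofFn (dominantRep x) : Multiset ℤ) = univ.val.map x := by
  rw [Fin.univ_val_map, Multiset.coe_eq_coe]
  exact Equiv.Perm.ofFn_comp_perm (Tuple.sort fun j => -x j) x

theorem betheFunction_mem_weylInvariants (p : Fin k → ℂ) :
    betheFunction α β γ δ p ∈ weylInvariants k := by
  intro w x
  rw [betheFunction, betheFunction]
  congr 1
  refine List.ofFn_injective (ofFn_dominantRep_eq
    (Antitone.sortedGE_ofFn (dominantRep_mem x)) ?_)
  rw [coe_ofFn_dominantRep, Fin.univ_val_map, Fin.univ_val_map, Multiset.coe_eq_coe]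
  exact (Equiv.Perm.ofFn_comp_perm w x).symm

theorem betheFunction_of_mem_dominantChamber (p : Fin k → ℂ) {x : Lattice k}
    (hx : x ∈ dominantChamber k) : betheFunction α β γ δ p x = betheSum α β γ δ p x := by
  rw [betheFunction]
  congr 1
  exact List.ofFn_injective (ofFn_dominantRep_eq (Antitone.sortedGE_ofFn hx)
    (Fin.univ_val_map x).symm)

/-- The indices of the coordinates of `x` that are equal to `c`. -/
def level (x : Lattice k) (c : ℤ) : Finset (Fin k) := univ.filter fun i => x i = c

theorem card_level {x : Lattice k} {l : List ℤ} (hx : (l : Multiset ℤ) = univ.val.map x) (c : ℤ) :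
    (level x c).card = l.count c := by
  rw [← Multiset.coe_count, hx, Multiset.count_map, level, card_def, filter_val]
  simp only [eq_comm]

theorem betheFunction_sub_sum {p : Fin k → ℂ} (hp : Function.Injective p) {x : Lattice k}
    {l : List ℤ} (hl : l.SortedGE) (hx : (l : Multiset ℤ) = univ.val.map x) {c : ℤ}
    {J : Finset (Fin k)} (hJ : J ⊆ level x c) :
    betheFunction α β γ δ p (x - ∑ i ∈ J, basisVec i) =
      powerSum α β γ δ (lowered c J.card l) (univ.image p) := by
  refine betheFunction_eq_powerSum _ _ _ _ hp (lowered_sortedGE c _ hl).sortedGE ?_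
  have hr : J.card ≤ l.count c := card_level hx c ▸ card_le_card hJ
  apply add_right_cancel (b := Multiset.replicate J.card c)
  rw [coe_lowered_add c hl hr, hx]
  have hval : ∀ i, (x - ∑ j ∈ J, basisVec j) i = if i ∈ J then x i - 1 else x i := by
    intro i
    simp only [Pi.sub_apply, Finset.sum_apply, basisVec, Pi.single_apply]
    split_ifs with h <;> simp [h]
  have hsplit : ∀ y : Lattice k, univ.val.map y = J.val.map y + Jᶜ.val.map y := by
    intro y
    rw [← Multiset.map_add, ← union_compl J, ← disjUnion_eq_union _ _ disjoint_compl_right,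
      disjUnion_val]
  have h1 : J.val.map x = Multiset.replicate J.card c :=
    Multiset.eq_replicate.2 ⟨Multiset.card_map _ _, fun b hb => by
      obtain ⟨i, hi, rfl⟩ := Multiset.mem_map.1 hb
      exact (mem_filter.1 (hJ (mem_val.mp hi))).2⟩
  have h2 : J.val.map (x - ∑ j ∈ J, basisVec j) = Multiset.replicate J.card (c - 1) :=
    Multiset.eq_replicate.2 ⟨Multiset.card_map _ _, fun b hb => by
      obtain ⟨i, hi, rfl⟩ := Multiset.mem_map.1 hb
      rw [hval, if_pos (mem_val.mp hi), (mem_filter.1 (hJ (mem_val.mp hi))).2]⟩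
  have h3 : Jᶜ.val.map (x - ∑ j ∈ J, basisVec j) = Jᶜ.val.map x :=
    Multiset.map_congr rfl fun i hi => (hval i).trans (if_neg (mem_compl.1 (mem_val.mp hi)))
  rw [hsplit, hsplit, h1, h2, h3]
  abel

theorem prod_map_shiftOp (l : List (Fin k)) (g : Lattice k → ℂ) (x : Lattice k) :
    (l.map shiftOp).prod g x = g (x - (l.map basisVec).sum) := by
  induction l generalizing x with
  | nil => simp
  | cons i l ih =>
    rw [List.map_cons, List.prod_cons, Module.End.mul_apply, List.map_cons, List.sum_cons,
      ← sub_sub, ← ih]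
    rfl

theorem prod_ofFn_shiftOp {r : ℕ} {j : Fin r → Fin k} (hj : Function.Injective j)
    (g : Lattice k → ℂ) (x : Lattice k) :
    (List.ofFn fun a => shiftOp (j a)).prod g x = g (x - ∑ i ∈ univ.image j, basisVec i) := by
  have h1 : (List.ofFn fun a => shiftOp (j a)) = (List.ofFn j).map shiftOp :=
    by rw [List.map_ofFn]; rfl
  rw [h1, prod_map_shiftOp, List.map_ofFn, List.sum_ofFn, sum_image hj.injOn]
  rfl

theorem sum_filter_strictMono (r : ℕ) (F : (Fin r → Fin k) → ℂ) (G : Finset (Fin k) → ℂ)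
    [DecidablePred fun j : Fin r → Fin k => StrictMono j]
    (h : ∀ j, StrictMono j → F j = G (univ.image j)) :
    ∑ j ∈ univ.filter (fun j : Fin r → Fin k => StrictMono j), F j =
      ∑ J ∈ powersetCard r univ, G J := by
  refine sum_bij (fun j _ => univ.image j) ?_ ?_ ?_ ?_
  · intro j hj
    have hj := (mem_filter.1 hj).2
    exact mem_powersetCard.2 ⟨subset_univ _, by simp [card_image_of_injective _ hj.injective]⟩
  · intro j hj j' hj' he
    have hj := (mem_filter.1 hj).2
    have hj' := (mem_filter.1 hj').2
    refine (hj.range_inj hj').1 ?_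
    simpa using congrArg (fun s : Finset (Fin k) => (s : Set (Fin k))) he
  · intro J hJ
    have hJ := (mem_powersetCard.1 hJ).2
    exact ⟨J.orderEmbOfFin hJ, mem_filter.2 ⟨mem_univ _, (J.orderEmbOfFin hJ).strictMono⟩,
      image_orderEmbOfFin_univ J hJ⟩
  · exact fun j hj => h j (mem_filter.1 hj).2

theorem dPlus_eq (x : Lattice k) (i : Fin k) :
    dPlus i x = ((level x (x i)).filter (i < ·)).card := by
  rw [dPlus, level, filter_filter]
  congr 1; ext p; simp [and_comm, eq_comm]

theorem dMinus_eq (x : Lattice k) (i : Fin k) :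
    dMinus i x = ((level x (x i)).filter (· < i)).card := by
  rw [dMinus, level, filter_filter]
  congr 1; ext p; simp [and_comm]

theorem dPlus_add_dMinus (x : Lattice k) (i : Fin k) :
    dPlus i x + dMinus i x = (level x (x i)).card - 1 := by
  have hi : i ∈ level x (x i) := by simp [level]
  rw [dPlus_eq, dMinus_eq, ← card_erase_of_mem hi, ← card_union_of_disjoint]
  · congr 1; ext p; simp only [mem_union, mem_filter, mem_erase]; grind
  · rw [disjoint_filter]; exact fun _ _ h => h.not_gt

/-- The value at a set `J` of `s + 1` indices of the summand of the discrete Hamiltonian applied to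
a Bethe wave function. -/
def loweringSummand (x : Lattice k) (s : ℕ) (p : Fin k → ℂ) (l : List ℤ) (J : Finset (Fin k)) : ℂ :=
  ∑ c ∈ univ.image x, if J ⊆ level x c then
    (-(β * δ)) ^ s * qFactorial (qParam α β γ δ) s *
    (qParam α β γ δ ^ ((s + 1) * s / 2))⁻¹ / (∏ a ∈ range (s + 1),
      (1 + β * γ * qInt (qParam α β γ δ) (l.count c - 1 - a))) *
    powerSum α β γ δ (lowered c (s + 1) l) (univ.image p) *
    qParam α β γ δ ^ (∑ i ∈ J, ((level x c).filter (· < i)).card) else 0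

/-- A nonempty index set lies in at most one level, and it lies in one exactly when `deltaFun` is
`1`. -/
theorem hamiltonianCoeff_mul_eq (x : Lattice k) (s : ℕ) {j : Fin (s + 1) → Fin k}
    (hj : Function.Injective j) {p : Fin k → ℂ} (hp : Function.Injective p)
    {l : List ℤ} (hl : l.SortedGE) (hx : (l : Multiset ℤ) = univ.val.map x) :
    hamiltonianCoeff α β γ δ (s + 1) j x *
      betheFunction α β γ δ p (x - ∑ i ∈ univ.image j, basisVec i) =
      loweringSummand α β γ δ x s p l (univ.image j) := by
  rw [loweringSummand]
  by_cases hconst : ∀ a b, x (j a) = x (j b)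
  · have hsub : univ.image j ⊆ level x (x (j 0)) := by
      intro i hi
      obtain ⟨a, _, rfl⟩ := mem_image.1 hi
      simp [level, hconst a 0]
    rw [sum_eq_single (x (j 0))]
    · rw [if_pos hsub, betheFunction_sub_sum _ _ _ _ hp hl hx hsub,
        card_image_of_injective _ hj, hamiltonianCoeff, deltaFun, if_pos hconst,
        dPlus_add_dMinus, card_level hx, card_univ, Fintype.card_fin, sum_image hj.injOn,
        sum_congr rfl fun a _ => by rw [dMinus_eq, hconst a 0], Nat.add_sub_cancel]
      ring
    · intro c _ hc
      refine if_neg fun h => hc ?_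
      have := h (mem_image_of_mem j (mem_univ 0))
      simpa [level, eq_comm] using this
    · intro h; exact absurd (mem_image_of_mem x (mem_univ _)) h
  · rw [hamiltonianCoeff, deltaFun, if_neg hconst]
    symm
    rw [sum_eq_zero]
    · simp
    · intro c _
      refine if_neg fun h => hconst fun a b => ?_
      have ha := h (mem_image_of_mem j (mem_univ a))
      have hb := h (mem_image_of_mem j (mem_univ b))
      simp only [level, mem_filter, mem_univ, true_and] at ha hb
      rw [ha, hb]

theorem hamiltonian_betheFunction_apply {p : Fin k → ℂ} (hp : Function.Injective p) (x : Lattice k)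
    {l : List ℤ} (hl : l.SortedGE) (hx : (l : Multiset ℤ) = univ.val.map x) :
    hamiltonian k α β γ δ (betheFunction α β γ δ p) x =
      ∑ c ∈ l.toFinset, levelTerm α β γ δ c l (univ.image p) := by
  classical
  have himg : l.toFinset = univ.image x := by
    ext a
    rw [List.mem_toFinset, ← Multiset.mem_coe, hx]
    simp
  have hdiag : ∑ j, qInt (qParam α β γ δ) (dPlus j x) /
      (1 + β * γ * qInt (qParam α β γ δ) (dPlus j x)) =
      ∑ c ∈ univ.image x, diagCoeff α β γ δ (l.count c) := by
    rw [← sum_fiberwise_of_maps_to (g := x) (t := univ.image x)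
      fun i hi => mem_image_of_mem x hi]
    refine sum_congr rfl fun c _ => ?_
    rw [diagCoeff, ← card_level hx, ← sum_comp_corank
      (fun d => qInt (qParam α β γ δ) d / (1 + β * γ * qInt (qParam α β γ δ) d))]
    refine sum_congr rfl fun j hj => ?_
    rw [dPlus_eq, (mem_filter.1 hj).2]
  have hoff : ∀ s, ∑ j ∈ univ.filter (fun j : Fin (s + 1) → Fin k => StrictMono j),
      hamiltonianCoeff α β γ δ (s + 1) j x *
        (List.ofFn fun a : Fin (s + 1) => shiftOp (j a)).prod (betheFunction α β γ δ p) x =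
      ∑ c ∈ univ.image x, lowerCoeff α β γ δ (l.count c) (s + 1) *
        powerSum α β γ δ (lowered c (s + 1) l) (univ.image p) := by
    intro s
    rw [sum_filter_strictMono (s + 1) _ (loweringSummand α β γ δ x s p l) fun j hj => by
      rw [prod_ofFn_shiftOp hj.injective,
        hamiltonianCoeff_mul_eq α β γ δ x s hj.injective hp hl hx]]
    simp only [loweringSummand]
    rw [sum_comm]
    refine sum_congr rfl fun c _ => ?_
    have hfil : (powersetCard (s + 1) univ).filter (· ⊆ level x c) =
        powersetCard (s + 1) (level x c) := by
      ext J; simp [mem_powersetCard, and_comm]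
    rw [← sum_filter, hfil, ← mul_sum, sum_pow_rank _ _ (level x c), card_level hx, lowerCoeff,
      Nat.add_sub_cancel]
    ring
  have hΦ := betheFunction_eq_powerSum α β γ δ hp hl hx
  have hcalc : hamiltonian k α β γ δ (betheFunction α β γ δ p) x =
      -(α * γ) * ((∑ j, qInt (qParam α β γ δ) (dPlus j x) /
        (1 + β * γ * qInt (qParam α β γ δ) (dPlus j x))) * betheFunction α β γ δ p x) +
      ∑ s ∈ range k, ∑ j ∈ univ.filter (fun j : Fin (s + 1) → Fin k => StrictMono j),
        hamiltonianCoeff α β γ δ (s + 1) j x *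
        (List.ofFn fun a : Fin (s + 1) => shiftOp (j a)).prod (betheFunction α β γ δ p) x := by
    simp only [hamiltonian, LinearMap.add_apply, LinearMap.smul_apply, LinearMap.sum_apply,
      Pi.add_apply, Pi.smul_apply, Finset.sum_apply, smul_eq_mul, Module.End.mul_apply, mulOp,
      LinearMap.mulLeft_apply, Pi.mul_apply, sum_mul]
  rw [hcalc, hdiag, hΦ, sum_congr rfl fun s _ => hoff s, sum_comm, himg, sum_mul, mul_sum,
    ← sum_add_distrib]
  refine sum_congr rfl fun c _ => ?_
  rw [levelTerm, ← mul_assoc]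
  congr 1
  have hle : l.count c ≤ k := by
    rw [← card_level hx]; exact (card_le_univ _).trans (by simp)
  -- `H` sums up to `r = k`; the terms with `r` above the multiplicity of `c` vanish.
  refine (sum_subset (range_subset_range.2 hle) fun s _ hs => ?_).symm
  rw [lowerCoeff_of_lt _ _ _ _ (by simpa [Nat.lt_succ_iff] using hs), zero_mul]

theorem hamiltonian_betheFunction (hq : qParam α β γ δ ≠ 0)
    (hH : ∀ n : ℕ, 0 < n → 1 + β * γ * qInt (qParam α β γ δ) n ≠ 0)
    {p : Fin k → ℂ} (hp : Function.Injective p) (hp0 : ∀ i, p i ≠ 0) :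
    hamiltonian k α β γ δ (betheFunction α β γ δ p) =
      (∑ i, p i) • betheFunction α β γ δ p := by
  funext x
  have hl := Antitone.sortedGE_ofFn (dominantRep_mem x)
  have hx := coe_ofFn_dominantRep x
  have hH' : ∀ n : ℕ, 1 + β * γ * qInt (qParam α β γ δ) n ≠ 0 := fun n => by
    rcases Nat.eq_zero_or_pos n with rfl | hn
    · simp [qInt_zero]
    · exact hH n hn
  rw [hamiltonian_betheFunction_apply _ _ _ _ hp x hl hx, sum_levelTerm _ _ _ _ hq hH' _ hl,
    Pi.smul_apply, betheFunction_eq_powerSum _ _ _ _ hp hl hx, sum_image hp.injOn, smul_eq_mul]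
  · rw [card_image_of_injective _ hp]; simp
  · simpa using hp0

end function

/-! ### Linear independence of plane waves on the dominant chamber. -/

section nonvanishing

variable {k : ℕ}

/-- The antitone points of the lattice as an additive monoid. -/
def dominantMonoid (k : ℕ) : AddSubmonoid (Lattice k) where
  carrier := dominantChamber k
  zero_mem' := fun _ _ _ => le_rfl
  add_mem' := fun hx hy => Antitone.add hx hy

/-- The character `x ↦ ∏ i, p i ^ (-x i)` of the monoid of antitone lattice points. -/
def planeWave (p : Fin k → ℂ) (hp0 : ∀ i, p i ≠ 0) : Multiplicative (dominantMonoid k) →* ℂ where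
  toFun x := ∏ i, p i ^ (-(x.toAdd : Lattice k) i)
  map_one' := by simp
  map_mul' x y := by
    rw [← prod_mul_distrib]
    refine prod_congr rfl fun i _ => ?_
    rw [← zpow_add₀ (hp0 i)]
    simp [add_comm]

theorem planeWave_injective {p p' : Fin k → ℂ} (hp0 : ∀ i, p i ≠ 0) (hp0' : ∀ i, p' i ≠ 0)
    (h : planeWave p hp0 = planeWave p' hp0') : p = p' := by
  funext i
  -- The staircase points `E i` and `E (i + 1)` are dominant, and the ratio of the character values
  -- there is `(p i)⁻¹`.
  let E : ℕ → Lattice k := fun n a => if (a : ℕ) < n then 1 else 0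
  have hE : ∀ n, E n ∈ dominantMonoid k := fun n a b hab => by
    have : (a : ℕ) ≤ b := hab
    simp only [E]; split_ifs <;> omega
  have hval : ∀ n, ∏ a, p a ^ (-E n a) = ∏ a, p' a ^ (-E n a) := fun n =>
    DFunLike.congr_fun h (Multiplicative.ofAdd (⟨E n, hE n⟩ : dominantMonoid k))
  have hstep : ∀ r : Fin k → ℂ, (∀ a, r a ≠ 0) →
      ∏ a, r a ^ (-E (i + 1) a) = (∏ a, r a ^ (-E i a)) * (r i)⁻¹ := by
    intro r hr
    have : ∀ a, r a ^ (-E (i + 1) a) = r a ^ (-E i a) * if a = i then (r i)⁻¹ else 1 := by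
      intro a
      rcases lt_trichotomy (a : ℕ) i with hlt | heq | hgt
      · have : a ≠ i := fun h => by simp [h] at hlt
        simp [E, hlt, this, Nat.lt_succ_of_lt hlt]
      · have : a = i := Fin.ext heq
        subst this
        simp [E]
      · have : a ≠ i := fun h => by simp [h] at hgt
        simp [E, hgt.not_gt, this, show ¬ (a : ℕ) < i + 1 by omega]
    rw [prod_congr rfl fun a _ => this a, prod_mul_distrib]
    simp
  have h1 := hval (i + 1)
  rw [hstep p hp0, hstep p' hp0', hval i] at h1
  exact inv_injective (mul_left_cancel₀
    (prod_ne_zero_iff.2 fun a _ => zpow_ne_zero _ (hp0' a)) h1)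

theorem eq_zero_of_sum_mul_prod_zpow_eq_zero {p : Fin k → ℂ} (hp : Function.Injective p)
    (hp0 : ∀ i, p i ≠ 0) (A : Equiv.Perm (Fin k) → ℂ)
    (h : ∀ x ∈ dominantChamber k, ∑ σ, A σ * ∏ i, p (σ i) ^ (-x i) = 0)
    (σ : Equiv.Perm (Fin k)) : A σ = 0 := by
  have hli := (linearIndependent_monoidHom (Multiplicative (dominantMonoid k)) ℂ).comp
    (fun σ : Equiv.Perm (Fin k) => planeWave (fun i => p (σ i)) fun i => hp0 _) (by
      intro σ τ hστ
      ext i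
      exact congrArg _ (hp (congrFun (planeWave_injective _ _ hστ) i)))
  refine Fintype.linearIndependent_iff.1 hli A ?_ σ
  funext x
  simpa [planeWave] using h _ x.toAdd.2

end nonvanishing

end BetheWave

end

theorem mainTheorem2 (k : ℕ) (hk : 2 ≤ k) (α β γ δ : ℂ)
    (hq : qParam α β γ δ ≠ 0)
    (hH : ∀ n : ℕ, 0 < n → 1 + β * γ * qInt (qParam α β γ δ) n ≠ 0)
    (p : Fin k → ℂ) (hp : Function.Injective p) (hp0 : ∀ i, p i ≠ 0) :
    betheFunction α β γ δ p ∈ weylInvariants k ∧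
    (∀ x ∈ dominantChamber k, betheFunction α β γ δ p x =
      ∑ σ : Equiv.Perm (Fin k),
        (∏ i : Fin k, ∏ j ∈ Finset.Ioi i,
          (1 + (α + β * p (σ j)) * (γ + δ * p (σ i)) / (p (σ j) - p (σ i)))) *
        ∏ i : Fin k, p (σ i) ^ (-x i)) ∧
    hamiltonian k α β γ δ (betheFunction α β γ δ p) = (∑ i, p i) • betheFunction α β γ δ p ∧
    (betheFunction α β γ δ p ≠ 0 ↔ ∃ σ : Equiv.Perm (Fin k), betheCoeff α β γ δ p σ ≠ 0) ∧
    ((∀ n : ℕ, 2 ≤ n → n ≤ k → qInt (qParam α β γ δ) n ≠ 0) →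
      Module.End.HasEigenvector (hamiltonian k α β γ δ) (∑ i, p i)
        (betheFunction α β γ δ p)) := by
  have heig := hamiltonian_betheFunction α β γ δ hq hH hp hp0
  refine ⟨betheFunction_mem_weylInvariants α β γ δ p,
    fun x hx => betheFunction_of_mem_dominantChamber α β γ δ p hx, heig, ⟨?_, ?_⟩, ?_⟩
  · intro h
    by_contra! h0
    exact h (funext fun x => by simp [betheFunction, betheSum, h0])
  · rintro ⟨σ, hσ⟩ h0
    refine hσ (eq_zero_of_sum_mul_prod_zpow_eq_zero hp hp0 _ (fun x hx => ?_) σ)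
    rw [← betheSum, ← betheFunction_of_mem_dominantChamber _ _ _ _ _ hx, h0]
    rfl
  · intro hn
    refine ⟨Module.End.mem_eigenspace_iff.2 heig, fun h0 => ?_⟩
    have hcard : (Finset.univ.image p).card = k := by
      rw [Finset.card_image_of_injective _ hp]; simp
    -- At the origin all weights are `1`, so the value is the sum of all the Bethe coefficients.
    have h1 : betheFunction α β γ δ p 0 = qFactorial (qParam α β γ δ) k := by
      have h2 := powerSum_replicate α β γ δ 0 (Finset.univ.image p)
      rw [hcard] at h2
      rw [betheFunction_eq_powerSum α β γ δ hp (l := List.replicate k 0) _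
        (by rw [Multiset.coe_replicate]; simp), h2]
      · simp
      · exact List.Pairwise.sortedGE (List.pairwise_replicate.2 (Or.inr (show (0 : ℤ) ≥ 0 from le_rfl)))
    rw [h0] at h1
    refine Finset.prod_ne_zero_iff.2 (fun n hmem => ?_) h1.symm
    have hmem := Finset.mem_Icc.1 hmem
    rcases hmem.1.eq_or_lt with rfl | h
    · rw [qInt_one]; exact one_ne_zero
    · exact hn n h hmem.2
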